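/- **Definitions.** All maps are over $\mathbb C$. For $X\in\mathbb C^N$, $X^{*3}$ denotes the componentwise cube. A map $f:\mathbb C^n\to\mathbb C^n$ is *cubic-homogeneous* if $f(x)=x-g(x,x,x)$ for some symmetric trilinear $g:(\mathbb C^n)^3\to\mathbb C^n$; a map $F:\mathbb C^N\to\mathbb C^N$ is *cubic-linear* if $F(X)=X-(AX)^{*3}$ for some $N\times N$ matrix $A$. Such $f$ and $F$ are *paired* through an $n\times N$ matrix $B$ and an $N\times n$ matrix $C$ if $\ker A=\ker B$, $BC=I_n$ and $f(x)=BF(Cx)$ for all $x\in\mathbb C^n$. (Then $n=\operatorname{rank}A\le N$.) For $\lambda\in\mathbb C$, a *global pre-conjugation* of a map $\varphi:\mathbb C^m\to\mathbb C^m$ is an analytic map $\kappa:\mathbb C^m\to\mathbb C^m$ with $\kappa(0)=0$, $\kappa'(0)=I_m$ and $\lambda\varphi(\kappa(y))=\kappa(\lambda y)$ for all $y\in\mathbb C^m$. "Has a polynomial inverse" means: is bijective and the inverse map is polynomial. **Theorem 1.3.** (i) Every cubic-homogeneous map $f:\mathbb C^n\to\mathbb C^n$ is paired with some cubic-linear map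 $F:\mathbb C^N\to\mathbb C^N$ with $N>n$. Every cubic-linear map $F(X)=X-(AX)^{*3}$ on $\mathbb C^N$ is paired with some cubic-homogeneous map $f:\mathbb C^n\to\mathbb C^n$ with $n\le N$, and with $n<N$ if $A$ is singular. (ii) Let $f$ and $F$ be paired through $B$ and $C$. Each of the following holds for $f$ if and only if it holds for $F$: being one-to-one; being onto; having a polynomial inverse; having constant Jacobian determinant. Moreover, for all $x\in\mathbb C^n$, $X\in\mathbb C^N$, $$f(BX)=BF(X),\qquad \det f'(x)=\det F'(Cx),\qquad \det F'(X)=\det f'(BX),$$ and, when $f$ and $F$ are bijective, for all $y\in\mathbb C^n$, $Y\in\mathbb C^N$, $$f^{-1}(y)=BF^{-1}(Cy),\qquad F^{-1}(Y)=Y-F\bigl(Cf^{-1}(BY)\bigr)+Cf^{-1}(BY).$$ (iii) Let $f$ and $F$ be paired through $B$ and $C$ and let $\lambda\in\mathbb C\setminus\{0\}$, $|\lambda|\neq1$. Each of $f$, $F$ has at most one global pre-conjugation for $\lambda$. One of them has a global pre-conjugation if and only if the other has. Each of them has one if $|\lambda|>1$, and also if it is bijective. If $k_\lambda$ and $K_\lambda$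 are the global pre-conjugations of $f$ and $F$, then each of the following holds for $k_\lambda$ if and only if it holds for $K_\lambda$: being onto; being one-to-one; being a polynomial map; having a polynomial inverse. Moreover, for all $x\in\mathbb C^n$, $X\in\mathbb C^N$, $$k_\lambda(x)=BK_\lambda(Cx),\qquad k_\lambda(BX)=BK_\lambda(X),$$ and, when $k_\lambda$ and $K_\lambda$ are bijective, for all $y\in\mathbb C^n$, $Y\in\mathbb C^N$, $$k_\lambda^{-1}(y)=BK_\lambda^{-1}(Cy),\qquad K_\lambda^{-1}(Y)=Y-K_\lambda\bigl(Ck_\lambda^{-1}(BY)\bigr)+Ck_\lambda^{-1}(BY).$$ -/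

import Mathlib

open Matrix

/-- `f : ℂⁿ → ℂⁿ` is cubic-homogeneous: `f x = x - g(x,x,x)` with `g` trilinear and symmetric. -/
def IsCubicHomogeneous {n : ℕ} (f : (Fin n → ℂ) → (Fin n → ℂ)) : Prop :=
  ∃ g : MultilinearMap ℂ (fun _ : Fin 3 => (Fin n → ℂ)) (Fin n → ℂ),
    (∀ (σ : Equiv.Perm (Fin 3)) (v : Fin 3 → (Fin n → ℂ)), g (v ∘ σ) = g v) ∧
    ∀ x, f x = x - g (fun _ => x)

/-- The cubic-linear map `X ↦ X - (A X)^{*3}`; the cube is taken componentwise. -/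
def cubicLinear {N : ℕ} (A : Matrix (Fin N) (Fin N) ℂ) (X : Fin N → ℂ) : Fin N → ℂ :=
  X - (A *ᵥ X) ^ 3

/-- `f` and `F X = X - (A X)^{*3}` are paired through `B` and `C`. No relation between the
dimensions is imposed here: the conditions force `n = rank A`, so that `n ≤ N`, and `n < N`
exactly when `A` is singular. -/
structure Paired {n N : ℕ} (f : (Fin n → ℂ) → (Fin n → ℂ)) (A : Matrix (Fin N) (Fin N) ℂ)
    (B : Matrix (Fin n) (Fin N) ℂ) (C : Matrix (Fin N) (Fin n) ℂ) : Prop where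
  ker_eq : LinearMap.ker A.mulVecLin = LinearMap.ker B.mulVecLin
  mul_eq_one : B * C = 1
  apply_eq : ∀ x, f x = B *ᵥ cubicLinear A (C *ᵥ x)

/-- All components are polynomials in the coordinates. -/
def IsPolynomialMap {n m : ℕ} (f : (Fin n → ℂ) → (Fin m → ℂ)) : Prop :=
  ∃ p : Fin m → MvPolynomial (Fin n) ℂ, ∀ x i, f x i = MvPolynomial.eval x (p i)

/-- `g` is the (two-sided) inverse of the map `f`. -/
def IsInverse {α β : Type*} (g : β → α) (f : α → β) : Prop :=
  Function.LeftInverse g f ∧ Function.RightInverse g f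

/-- `f` is invertible and its inverse is a polynomial map. -/
def HasPolynomialInverse {n : ℕ} (f : (Fin n → ℂ) → (Fin n → ℂ)) : Prop :=
  ∃ g : (Fin n → ℂ) → (Fin n → ℂ), IsInverse g f ∧ IsPolynomialMap g

/-- The Jacobian determinant `det f'(x)`. -/
noncomputable def jacobianDet {n : ℕ} (f : (Fin n → ℂ) → (Fin n → ℂ)) (x : Fin n → ℂ) : ℂ :=
  (fderiv ℂ f x).det

/-- `k` is a global pre-conjugation of `f` for the parameter `lam`: an analytic map on all of `ℂⁿ`
with `k 0 = 0`, `k' 0 = I` and `lam f(k(y)) = k(lam y)` (invertibility of `k` is not required). -/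
structure IsGlobalPreconjugation {n : ℕ} (lam : ℂ) (f k : (Fin n → ℂ) → (Fin n → ℂ)) : Prop where
  analytic : AnalyticOnNhd ℂ k Set.univ
  map_zero : k 0 = 0
  deriv_zero : HasFDerivAt k (ContinuousLinearMap.id ℂ (Fin n → ℂ)) 0
  conj : ∀ y, lam • f (k y) = k (lam • y)

/-! Since `ker A = ker B`, the map `F` satisfies `F (X + v) = F X + v` for `v` in `ker B`, and `B F
= f B`. So `F` is fibred over `f` by the projection `B` and acts as a translation on each fibre.
`IsLift` isolates this structure: injectivity, surjectivity and the inverse formulas follow formally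
from it. Jacobians agree by `det (1 - M N) = det (1 - N M)`. Polynomial invertibility is the same as
bijectivity, because a bijective polynomial self-map of `ℂⁿ` has a polynomial inverse. Pairings come
from writing a cubic form as a sum of cubes of linear forms and, conversely, from factoring `A`
through its range.

For pre-conjugations, `|lam| ≠ 1` excludes resonances `lam ^ d = lam` with `d ≥ 2`, which gives
uniqueness (`eqOn_ball_of_local_conj`). A local solution comes from the inverse function theorem in
a space of bounded sequences (`exists_local_solution`). It extends globally whenever the functional
equation expresses `k y` through the value at a contracted point (`exists_analytic_extension`): `k y
= lam f(k(y / lam))` if `|lam| > 1`, and `k y = f⁻¹(k(lam y) / lam)` if `|lam| < 1` and `f` is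
bijective.

Uniqueness makes `K` a lift of `k`, so the formal transfer applies again. Moreover `A K X = A C k(B
X)`, so once `k` is known the equation for `K` is linear: `K(lam X) = lam K X - lam (A C k(B X))^3`.
This equation extends a local `K` globally when `|lam| < 1`, and it has a polynomial solution when
`k` is polynomial. -/

/-- `K` commutes with translations along `ker B` and induces `k` through `B` and its section `C`. -/
structure IsLift {n N : ℕ} (B : Matrix (Fin n) (Fin N) ℂ) (C : Matrix (Fin N) (Fin n) ℂ)
    (k : (Fin n → ℂ) → (Fin n → ℂ)) (K : (Fin N → ℂ) → (Fin N → ℂ)) : Prop where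
  mul_eq_one : B * C = 1
  apply_add : ∀ X v, B *ᵥ v = 0 → K (X + v) = K X + v
  apply_eq : ∀ x, k x = B *ᵥ K (C *ᵥ x)

/-! ### Formal transfer along a lift -/

namespace IsLift

variable {n N : ℕ} {B : Matrix (Fin n) (Fin N) ℂ} {C : Matrix (Fin N) (Fin n) ℂ}
  {k : (Fin n → ℂ) → (Fin n → ℂ)} {K : (Fin N → ℂ) → (Fin N → ℂ)}

theorem mulVec_mulVec (h : B * C = 1) (x : Fin n → ℂ) : B *ᵥ (C *ᵥ x) = x := by
  rw [Matrix.mulVec_mulVec, h, one_mulVec]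

theorem mulVec_sub_section (h : B * C = 1) (X : Fin N → ℂ) :
    B *ᵥ (X - C *ᵥ (B *ᵥ X)) = 0 := by
  rw [mulVec_sub, mulVec_mulVec h, sub_self]

theorem apply_section (h : IsLift B C k K) (X : Fin N → ℂ) :
    K X = K (C *ᵥ (B *ᵥ X)) + (X - C *ᵥ (B *ᵥ X)) := by
  rw [← h.apply_add _ _ (mulVec_sub_section h.mul_eq_one X), add_sub_cancel]

theorem map_mulVec (h : IsLift B C k K) (X : Fin N → ℂ) : k (B *ᵥ X) = B *ᵥ K X := by
  rw [h.apply_eq, h.apply_section X, mulVec_add, mulVec_sub_section h.mul_eq_one, add_zero]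

theorem injective_iff (h : IsLift B C k K) : Function.Injective k ↔ Function.Injective K := by
  constructor
  · intro hk X Y hXY
    have h1 : B *ᵥ X = B *ᵥ Y := hk (by rw [h.map_mulVec, h.map_mulVec, hXY])
    have h2 := h.apply_add Y (X - Y) (by rw [mulVec_sub, h1, sub_self])
    rw [add_sub_cancel, hXY] at h2
    exact sub_eq_zero.1 (by simpa using h2.symm)
  · intro hK x y hxy
    rw [h.apply_eq, h.apply_eq] at hxy
    -- The difference of the two values lies in `ker B`; translating `C y` by it gives a second
    -- preimage of `K (C x)`.
    have h2 := h.apply_add (C *ᵥ y) (K (C *ᵥ x) - K (C *ᵥ y)) (by rw [mulVec_sub, hxy, sub_self])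
    rw [add_sub_cancel] at h2
    have h3 := congrArg (fun v => B *ᵥ v) (hK h2)
    simpa [mulVec_add, mulVec_mulVec h.mul_eq_one, mulVec_sub, hxy] using h3.symm

/-- The point `C x` is mapped into the fibre of `Y`, and the remaining error `Y - K (C x)` lies in
`ker B`, so a translation corrects it exactly. -/
theorem apply_inverse_formula (h : IsLift B C k K) {x : Fin n → ℂ} {Y : Fin N → ℂ}
    (hx : k x = B *ᵥ Y) : K (Y - K (C *ᵥ x) + C *ᵥ x) = Y := by
  rw [add_comm, h.apply_add _ _ (by rw [mulVec_sub, ← h.apply_eq, hx, sub_self]), add_sub_cancel]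

theorem surjective_iff (h : IsLift B C k K) : Function.Surjective k ↔ Function.Surjective K := by
  constructor
  · intro hk Y
    obtain ⟨x, hx⟩ := hk (B *ᵥ Y)
    exact ⟨_, h.apply_inverse_formula hx⟩
  · intro hK y
    obtain ⟨X, hX⟩ := hK (C *ᵥ y)
    exact ⟨B *ᵥ X, by rw [h.map_mulVec, hX, mulVec_mulVec h.mul_eq_one]⟩

theorem bijective_iff (h : IsLift B C k K) : Function.Bijective k ↔ Function.Bijective K :=
  and_congr h.injective_iff h.surjective_iff

theorem inverse_eq (h : IsLift B C k K) {kinv : (Fin n → ℂ) → (Fin n → ℂ)}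
    {Kinv : (Fin N → ℂ) → (Fin N → ℂ)} (hk : IsInverse kinv k) (hK : IsInverse Kinv K) :
    (∀ y, kinv y = B *ᵥ Kinv (C *ᵥ y)) ∧
      (∀ Y, Kinv Y = Y - K (C *ᵥ kinv (B *ᵥ Y)) + C *ᵥ kinv (B *ᵥ Y)) := by
  refine ⟨fun y => ?_, fun Y => ?_⟩
  · apply hk.1.injective.eq_iff.1 <| by
      rw [hk.2 y, h.map_mulVec, hK.2, mulVec_mulVec h.mul_eq_one]
  · apply hK.1.injective.eq_iff.1 <| by
      rw [hK.2 Y, h.apply_inverse_formula (hk.2 _)]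

end IsLift

/-! ### Paired maps are lifts -/

namespace Paired

variable {n N : ℕ} {f : (Fin n → ℂ) → (Fin n → ℂ)} {A : Matrix (Fin N) (Fin N) ℂ}
  {B : Matrix (Fin n) (Fin N) ℂ} {C : Matrix (Fin N) (Fin n) ℂ}

theorem mulVec_eq_zero_iff (h : Paired f A B C) (v : Fin N → ℂ) : A *ᵥ v = 0 ↔ B *ᵥ v = 0 := by
  have := SetLike.ext_iff.1 h.ker_eq v
  simpa using this

theorem mulVec_section (h : Paired f A B C) (X : Fin N → ℂ) : A *ᵥ (C *ᵥ (B *ᵥ X)) = A *ᵥ X := by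
  have := (h.mulVec_eq_zero_iff _).2 (IsLift.mulVec_sub_section h.mul_eq_one X)
  rw [mulVec_sub, sub_eq_zero] at this
  exact this.symm

theorem isLift (h : Paired f A B C) : IsLift B C f (cubicLinear A) where
  mul_eq_one := h.mul_eq_one
  apply_add X v hv := by
    simp only [cubicLinear, mulVec_add, (h.mulVec_eq_zero_iff v).2 hv, add_zero]
    abel
  apply_eq := h.apply_eq

end Paired

/-! ### Existence of pairings -/

section Trilinear

/-- The trilinear map `(u, v, w) ↦ M ((D u) * (D v) * (D w))`, products being componentwise. -/
noncomputable def cubeForm {n m N : ℕ} (M : Matrix (Fin m) (Fin N) ℂ)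
    (D : Matrix (Fin N) (Fin n) ℂ) :
    MultilinearMap ℂ (fun _ : Fin 3 => (Fin n → ℂ)) (Fin m → ℂ) :=
  M.mulVecLin.compMultilinearMap
    ((MultilinearMap.mkPiAlgebra ℂ (Fin 3) (Fin N → ℂ)).compLinearMap fun _ => D.mulVecLin)

theorem cubeForm_apply {n m N : ℕ} (M : Matrix (Fin m) (Fin N) ℂ) (D : Matrix (Fin N) (Fin n) ℂ)
    (v : Fin 3 → Fin n → ℂ) : cubeForm M D v = M *ᵥ ∏ i, D *ᵥ v i := by
  simp [cubeForm]

theorem cubeForm_symm {n m N : ℕ} (M : Matrix (Fin m) (Fin N) ℂ) (D : Matrix (Fin N) (Fin n) ℂ)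
    (σ : Equiv.Perm (Fin 3)) (v : Fin 3 → Fin n → ℂ) : cubeForm M D (v ∘ σ) = cubeForm M D v := by
  rw [cubeForm_apply, cubeForm_apply]
  congr 1
  exact Equiv.prod_comp σ fun i => D *ᵥ v i

theorem isCubicHomogeneous_cubicLinear {N : ℕ} (A : Matrix (Fin N) (Fin N) ℂ) :
    IsCubicHomogeneous (cubicLinear A) :=
  ⟨cubeForm 1 A, cubeForm_symm 1 A, fun x => by simp [cubicLinear, cubeForm_apply]⟩

end Trilinear

/-- Every cubic-linear map is paired with a cubic-homogeneous map. -/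
theorem exists_paired_cubicHomogeneous (N : ℕ) (A : Matrix (Fin N) (Fin N) ℂ) :
    ∃ n : ℕ, n ≤ N ∧ (A.det = 0 → n < N) ∧
      ∃ (f : (Fin n → ℂ) → (Fin n → ℂ)) (B : Matrix (Fin n) (Fin N) ℂ)
        (C : Matrix (Fin N) (Fin n) ℂ), IsCubicHomogeneous f ∧ Paired f A B C := by
  have hle : A.rank ≤ N := by simpa using A.rank_le_width
  refine ⟨A.rank, hle, fun hA => lt_of_le_of_ne hle fun h => ?_, ?_⟩
  · have : IsUnit A := by
      rw [← Matrix.linearIndependent_rows_iff_isUnit,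
        linearIndependent_iff_card_eq_finrank_span, Set.finrank,
        ← Matrix.rank_eq_finrank_span_row, h, Fintype.card_fin]
    rw [Matrix.isUnit_iff_isUnit_det, hA] at this
    simp at this
  · let e : LinearMap.range A.mulVecLin ≃ₗ[ℂ] (Fin A.rank → ℂ) :=
      LinearEquiv.ofFinrankEq _ _ (by rw [Module.finrank_fin_fun]; rfl)
    -- `A` corestricted to its range, in coordinates: surjective with the kernel of `A`. Any linear
    -- section of it serves as `C`.
    let b : (Fin N → ℂ) →ₗ[ℂ] (Fin A.rank → ℂ) := e.toLinearMap ∘ₗ A.mulVecLin.rangeRestrict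
    have hb : LinearMap.range b = ⊤ := by
      rw [LinearMap.range_comp, LinearMap.range_rangeRestrict, Submodule.map_top, LinearEquiv.range]
    obtain ⟨c, hc⟩ := b.exists_rightInverse_of_surjective hb
    have hBC : LinearMap.toMatrix' b * LinearMap.toMatrix' c = 1 := by
      rw [← LinearMap.toMatrix'_comp, hc, LinearMap.toMatrix'_id]
    refine ⟨fun x => LinearMap.toMatrix' b *ᵥ cubicLinear A (LinearMap.toMatrix' c *ᵥ x),
      LinearMap.toMatrix' b, LinearMap.toMatrix' c,
      ⟨cubeForm (LinearMap.toMatrix' b) (A * LinearMap.toMatrix' c), cubeForm_symm _ _,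
        fun x => ?_⟩,
      ?_, hBC, fun x => rfl⟩
    · simp only [cubicLinear]
      rw [mulVec_sub, IsLift.mulVec_mulVec hBC]
      rw [cubeForm_apply, Finset.prod_const, Finset.card_univ, Fintype.card_fin,
        ← Matrix.mulVec_mulVec]
    · ext v
      simp only [LinearMap.mem_ker, mulVecLin_apply, LinearMap.toMatrix'_mulVec]
      simp only [b, LinearMap.comp_apply, LinearEquiv.coe_coe, EmbeddingLike.map_eq_zero_iff]
      rw [Subtype.ext_iff]
      simp

/-- A map written with cubes of spanning linear forms is paired with a cubic-linear map. -/
theorem exists_paired_of_sum_cubes {n : ℕ} {ι : Type*} [Fintype ι] (f : (Fin n → ℂ) → (Fin n → ℂ))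
    (a b c : ι → Fin n → ℂ) (hf : ∀ x, f x = x - ∑ i, (a i ⬝ᵥ x) ^ 3 • b i)
    (ha : ∀ x, (∀ i, a i ⬝ᵥ x = 0) → x = 0) (hc : ∀ x, ∑ i, (c i ⬝ᵥ x) • b i = x) :
    ∃ (A : Matrix (Fin (Fintype.card ι)) (Fin (Fintype.card ι)) ℂ)
      (B : Matrix (Fin n) (Fin (Fintype.card ι)) ℂ) (C : Matrix (Fin (Fintype.card ι)) (Fin n) ℂ),
      Paired f A B C := by
  let e := Fintype.equivFin ι
  let D : Matrix (Fin (Fintype.card ι)) (Fin n) ℂ := of fun i => a (e.symm i)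
  let B : Matrix (Fin n) (Fin (Fintype.card ι)) ℂ := of fun j i => b (e.symm i) j
  let C : Matrix (Fin (Fintype.card ι)) (Fin n) ℂ := of fun i => c (e.symm i)
  have hB : ∀ v : ι → ℂ, B *ᵥ (fun i => v (e.symm i)) = ∑ i, v i • b i := by
    intro v
    ext j
    rw [Finset.sum_apply, ← e.symm.sum_comp]
    simp [B, mulVec, dotProduct, mul_comm]
  have hBC : B * C = 1 := by
    refine Matrix.mulVec_injective (funext fun x => ?_)
    rw [← Matrix.mulVec_mulVec, one_mulVec]
    exact (hB fun i => c i ⬝ᵥ x).trans (hc x)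
  have hD : ∀ x, D *ᵥ x = 0 → x = 0 := by
    intro x hx
    refine ha x fun i => ?_
    have := congrFun hx (e i)
    simpa [D, mulVec] using this
  refine ⟨D * B, B, C, ?_, hBC, fun x => ?_⟩
  · ext v
    simp only [LinearMap.mem_ker, mulVecLin_apply, ← Matrix.mulVec_mulVec]
    exact ⟨fun h => hD _ h, fun h => by rw [h, mulVec_zero]⟩
  · rw [cubicLinear, mulVec_sub, IsLift.mulVec_mulVec hBC, ← Matrix.mulVec_mulVec,
      IsLift.mulVec_mulVec hBC, hf]
    congr 1
    exact (hB fun i => (a i ⬝ᵥ x) ^ 3).symm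

theorem exists_paired_cubicLinear (n : ℕ) (f : (Fin n → ℂ) → (Fin n → ℂ))
    (hf : IsCubicHomogeneous f) :
    ∃ N : ℕ, n < N ∧ ∃ (A : Matrix (Fin N) (Fin N) ℂ) (B : Matrix (Fin n) (Fin N) ℂ)
      (C : Matrix (Fin N) (Fin n) ℂ), Paired f A B C := by
  obtain ⟨g, -, hg⟩ := hf
  let E : Fin n → Fin n → ℂ := fun i => Pi.single i 1
  have hE : ∀ i x, E i ⬝ᵥ x = x i := fun i x => by simp [E]
  have hEs : ∀ x : Fin n → ℂ, ∑ i, x i • E i = x := fun x => (pi_eq_sum_univ' x).symm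
  -- Signs of the polarization identity `24 u v w = (u+v+w)^3 + (u-v-w)^3 + (-u+v-w)^3 +
  -- (-u-v+w)^3`.
  let s : Fin 4 → Fin 3 → ℂ := ![![1, 1, 1], ![1, -1, -1], ![-1, 1, -1], ![-1, -1, 1]]
  -- The blocks: the cubes of `g`; all coordinate forms with zero coefficient vectors, so that the
  -- forms span; zero forms with the basis vectors, so that `B` has a section; and one dummy index,
  -- which makes the inequality strict even for `n = 0`.
  let ι := ((Fin 3 → Fin n) × Fin 4) ⊕ (Fin n ⊕ (Fin n ⊕ Unit))
  have hsum : ∀ x, g (fun _ => x) =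
      ∑ p : (Fin 3 → Fin n) × Fin 4,
        ((∑ l, s p.2 l • E (p.1 l)) ⬝ᵥ x) ^ 3 • ((24 : ℂ)⁻¹ • g fun l => E (p.1 l)) := by
    intro x
    have h1 : g (fun _ => x) = g fun _ => ∑ i, x i • E i := by rw [hEs]
    rw [h1, g.map_sum, Fintype.sum_prod_type]
    refine Finset.sum_congr rfl fun p _ => ?_
    rw [g.map_smul_univ]
    simp only [smul_smul]
    rw [← Finset.sum_smul]
    congr 1
    simp only [Fin.sum_univ_three, Fin.sum_univ_four, Fin.prod_univ_three, s, add_dotProduct,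
      smul_dotProduct, hE]
    simp
    ring
  obtain ⟨A, B, C, h⟩ := exists_paired_of_sum_cubes (ι := ι) f
    (Sum.elim (fun p => ∑ l, s p.2 l • E (p.1 l)) (Sum.elim E 0))
    (Sum.elim (fun p => (24 : ℂ)⁻¹ • g fun l => E (p.1 l)) (Sum.elim 0 (Sum.elim E 0)))
    (Sum.elim 0 (Sum.elim 0 (Sum.elim E 0)))
    (fun x => by simp only [ι, Fintype.sum_sum_type]; simp [hg, hsum])
    (fun x hx => funext fun i => by simpa [hE] using hx (.inr (.inl i)))
    (fun x => by simp only [ι, Fintype.sum_sum_type]; simp [hE, hEs])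
  refine ⟨_, ?_, A, B, C, h⟩
  simp only [ι, Fintype.card_sum, Fintype.card_fin, Fintype.card_unit]
  omega

/-! ### Jacobian determinants -/

section Jacobian

theorem hasFDerivAt_cubicLinear {N : ℕ} (A : Matrix (Fin N) (Fin N) ℂ) (X : Fin N → ℂ) :
    HasFDerivAt (cubicLinear A)
      (toLin' (1 - diagonal (fun i => 3 * (A *ᵥ X) i ^ 2) * A)).toContinuousLinearMap X := by
  rw [hasFDerivAt_pi']
  intro i
  have h1 : HasFDerivAt (fun X => (A *ᵥ X) i)
      ((ContinuousLinearMap.proj i).comp (toLin' A).toContinuousLinearMap) X :=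
    ((ContinuousLinearMap.proj (R := ℂ) (φ := fun _ : Fin N => ℂ) i).comp
      (toLin' A).toContinuousLinearMap).hasFDerivAt
  have h2 : HasFDerivAt (fun X : Fin N → ℂ => X i)
      (ContinuousLinearMap.proj (R := ℂ) (φ := fun _ : Fin N => ℂ) i) X :=
    (ContinuousLinearMap.proj (R := ℂ) (φ := fun _ : Fin N => ℂ) i).hasFDerivAt
  refine (h2.sub (h1.pow 3)).congr_fderiv ?_
  ext v
  simp only [_root_.sub_apply]
  simp
  rw [← mulVec_mulVec, mulVec_diagonal]

theorem jacobianDet_cubicLinear {N : ℕ} (A : Matrix (Fin N) (Fin N) ℂ) (X : Fin N → ℂ) :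
    jacobianDet (cubicLinear A) X = (1 - diagonal (fun i => 3 * (A *ᵥ X) i ^ 2) * A).det := by
  rw [jacobianDet, (hasFDerivAt_cubicLinear A X).fderiv, ← LinearMap.det_toLin']
  rfl

variable {n N : ℕ} {f : (Fin n → ℂ) → (Fin n → ℂ)} {A : Matrix (Fin N) (Fin N) ℂ}
  {B : Matrix (Fin n) (Fin N) ℂ} {C : Matrix (Fin N) (Fin n) ℂ}

theorem Paired.jacobianDet_eq (h : Paired f A B C) (x : Fin n → ℂ) :
    jacobianDet f x = jacobianDet (cubicLinear A) (C *ᵥ x) := by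
  set E := diagonal (fun i => 3 * (A *ᵥ (C *ᵥ x)) i ^ 2) with hE
  have hf : f = fun x => (toLin' B).toContinuousLinearMap
      (cubicLinear A ((toLin' C).toContinuousLinearMap x)) := funext h.apply_eq
  have hd : HasFDerivAt f (toLin' (B * (1 - E * A) * C)).toContinuousLinearMap x := by
    rw [hf]
    refine ((ContinuousLinearMap.hasFDerivAt _).comp x
      ((hasFDerivAt_cubicLinear A _).comp x (ContinuousLinearMap.hasFDerivAt _))).congr_fderiv ?_
    ext v
    simp [hE, mulVec_sub]
  -- This lets the swap `det (1 - B (E A C)) = det (1 - (E A C) B)` end in `det (1 - E A)`.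
  have hA : A * C * B = A := by
    refine Matrix.mulVec_injective (funext fun X => ?_)
    simpa [← Matrix.mulVec_mulVec] using h.mulVec_section X
  have h1 : jacobianDet f x = (B * (1 - E * A) * C).det := by
    rw [jacobianDet, hd.fderiv, ← LinearMap.det_toLin']
    rfl
  rw [h1, jacobianDet_cubicLinear, ← hE, Matrix.mul_sub, Matrix.sub_mul, Matrix.mul_one,
    h.mul_eq_one]
  rw [show B * (E * A) * C = B * (E * (A * C)) by simp only [Matrix.mul_assoc],
    det_one_sub_mul_comm]
  rw [Matrix.mul_assoc, hA]

theorem Paired.jacobianDet_cubicLinear_eq (h : Paired f A B C) (X : Fin N → ℂ) :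
    jacobianDet (cubicLinear A) X = jacobianDet f (B *ᵥ X) := by
  rw [h.jacobianDet_eq, jacobianDet_cubicLinear, jacobianDet_cubicLinear, h.mulVec_section]

theorem Paired.jacobianDet_const_iff (h : Paired f A B C) :
    (∃ c : ℂ, ∀ x, jacobianDet f x = c) ↔ (∃ c : ℂ, ∀ X, jacobianDet (cubicLinear A) X = c) :=
  ⟨fun ⟨c, hc⟩ => ⟨c, fun X => by rw [h.jacobianDet_cubicLinear_eq, hc]⟩,
    fun ⟨c, hc⟩ => ⟨c, fun x => by rw [h.jacobianDet_eq, hc]⟩⟩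

end Jacobian

/-! ### Bijective polynomial maps have polynomial inverses -/

section PolynomialInverse

open MvPolynomial

variable {σ : Type}

/-- Injectivity of a polynomial map on complex points is certified by the Nullstellensatz, hence
persists over every domain containing `ℂ`. -/
theorem MvPolynomial.eq_of_aeval_eq_of_injective [Finite σ] (F : σ → MvPolynomial σ ℂ)
    (hF : Function.Injective fun (x : σ → ℂ) j => eval x (F j))
    {Ω : Type*} [CommRing Ω] [IsDomain Ω] [Algebra ℂ Ω] (a b : σ → Ω)
    (hab : ∀ j, aeval a (F j) = aeval b (F j)) : a = b := by
  let I : Ideal (MvPolynomial (σ ⊕ σ) ℂ) :=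
    Ideal.span (Set.range fun j => rename Sum.inl (F j) - rename Sum.inr (F j))
  refine _root_.funext fun i => ?_
  have hmem : (X (Sum.inl i) - X (Sum.inr i) : MvPolynomial (σ ⊕ σ) ℂ) ∈ I.radical := by
    rw [← vanishingIdeal_zeroLocus_eq_radical (K := ℂ), mem_vanishingIdeal_iff]
    intro z hz
    have hz' : (fun i => z (Sum.inl i)) = fun i => z (Sum.inr i) := by
      refine hF (_root_.funext fun j => ?_)
      have := hz _ (Ideal.subset_span ⟨j, rfl⟩)
      rw [map_sub, aeval_rename, aeval_rename, sub_eq_zero] at this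
      simpa [coe_aeval_eq_eval, Function.comp_def] using this
    simpa [sub_eq_zero] using congrFun hz' i
  obtain ⟨e, he⟩ := hmem
  have hle : I ≤ RingHom.ker (aeval (R := ℂ) (Sum.elim a b)).toRingHom := by
    refine Ideal.span_le.2 ?_
    rintro _ ⟨j, rfl⟩
    simp [RingHom.mem_ker, aeval_rename, hab]
  have h0 := hle he
  rw [RingHom.mem_ker] at h0
  have h1 : (a i - b i) ^ e = 0 := by simpa using h0
  exact sub_eq_zero.1 (eq_zero_of_pow_eq_zero h1)

/-- A relation between the components vanishes on the image, which is all of affine space. -/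
theorem MvPolynomial.algebraicIndependent_of_surjective (F : σ → MvPolynomial σ ℂ)
    (hF : Function.Surjective fun (x : σ → ℂ) j => eval x (F j)) : AlgebraicIndependent ℂ F := by
  rw [algebraicIndependent_iff]
  intro p hp
  refine MvPolynomial.funext fun y => ?_
  obtain ⟨x, rfl⟩ := hF y
  have h := congrArg (eval x) hp
  rw [← coe_aeval_eq_eval, RingHom.coe_coe, map_zero] at h
  have h' := (comp_aeval_apply F (aeval x) p).symm.trans h
  simpa [coe_aeval_eq_eval] using h'

/-- The coordinates are rational functions of the components of a bijective polynomial map. -/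
theorem MvPolynomial.exists_X_mul_bind₁_eq [Finite σ] (F : σ → MvPolynomial σ ℂ)
    (hF : Function.Bijective fun (x : σ → ℂ) j => eval x (F j)) (i : σ) :
    ∃ r s : MvPolynomial σ ℂ, s ≠ 0 ∧ X i * bind₁ F s = bind₁ F r := by
  let R := MvPolynomial σ ℂ
  let L := FractionRing R
  let Ω := AlgebraicClosure L
  have hinj : Function.Injective (algebraMap R Ω) := by
    rw [IsScalarTower.algebraMap_eq R L Ω]
    exact (algebraMap L Ω).injective.comp (IsFractionRing.injective R L)
  have : FaithfulSMul R Ω := (faithfulSMul_iff_algebraMap_injective R Ω).2 hinj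
  have : Algebra.IsAlgebraic R Ω :=
    (IsFractionRing.comap_isAlgebraic_iff (A := R) (K := L)).2 inferInstance
  have hind := algebraicIndependent_of_surjective F hF.2
  have htr : IsTranscendenceBasis ℂ F :=
    hind.isTranscendenceBasis_of_lift_trdeg_le_of_finite (by simp [MvPolynomial.trdeg_of_isDomain])
  have hφ := (htr.algebraMap_comp (A := Ω))
  set φ : σ → Ω := algebraMap R Ω ∘ F with hφdef
  let ξ : σ → Ω := fun i => algebraMap R Ω (X i)
  have hξ : ∀ p : R, aeval ξ p = algebraMap R Ω p := by
    intro p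
    have := comp_aeval_apply (X : σ → R) (IsScalarTower.toAlgHom ℂ R Ω) p
    rw [aeval_X_left_apply] at this
    exact this.symm
  have hbind : ∀ p : R, aeval φ p = algebraMap R Ω (bind₁ F p) := fun p =>
    (comp_aeval_apply F (IsScalarTower.toAlgHom ℂ R Ω) p).symm
  -- `K = ℂ(F)`, over which `Ω` is algebraic by counting transcendence degree. If a coordinate were
  -- outside `K`, an automorphism of `Ω` over `K` would move it. The generic point and its image
  -- would then have equal values under `F`, against injectivity over `Ω`.
  let K := IntermediateField.adjoin ℂ (Set.range φ)
  have hK : Algebra.IsAlgebraic K Ω := hφ.isAlgebraic_field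
  have : IsAlgClosure K Ω := ⟨inferInstance, hK⟩
  have : Normal K Ω := IsAlgClosure.normal K Ω
  have hmem : ξ i ∈ K := by
    by_contra hnot
    have hnot' : ξ i ∉ (⊥ : Subalgebra K Ω) := by
      rintro ⟨z, hz⟩
      exact hnot (hz ▸ z.2)
    obtain ⟨y, hy, hconj⟩ := (notMem_iff_exists_ne_and_isConjRoot
      (Algebra.IsSeparable.isSeparable K _) (Normal.splits inferInstance _)).1 hnot'
    obtain ⟨τ, hτ⟩ := hconj.symm.exists_algEquiv
    let τ' : Ω →ₐ[ℂ] Ω := (τ.restrictScalars ℂ : Ω ≃ₐ[ℂ] Ω)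
    have hfix : ∀ j, τ' (φ j) = φ j := fun j =>
      τ.commutes ⟨φ j, IntermediateField.subset_adjoin _ _ ⟨j, rfl⟩⟩
    have := MvPolynomial.eq_of_aeval_eq_of_injective F hF.1 ξ (fun j => τ' (ξ j)) fun j => by
      rw [← comp_aeval_apply, hξ]
      exact (hfix j).symm
    exact hy ((congrFun this i).trans hτ)
  obtain ⟨r, s, hrs⟩ := (IntermediateField.mem_adjoin_range_iff ℂ φ _).1 hmem
  have hs : aeval φ s ≠ 0 := by
    intro h0
    rw [h0, div_zero, map_eq_zero_iff _ hinj] at hrs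
    exact X_ne_zero i hrs
  refine ⟨r, s, fun h => hs (by rw [h, map_zero]), hinj ?_⟩
  rw [map_mul, ← hbind, ← hbind]
  exact (eq_div_iff hs).1 hrs

/-- A bijective polynomial self-map of complex affine space has a polynomial inverse. -/
theorem MvPolynomial.exists_eval_eq_of_bijective [Finite σ] (F : σ → MvPolynomial σ ℂ)
    (hF : Function.Bijective fun (x : σ → ℂ) j => eval x (F j)) (i : σ) :
    ∃ q : MvPolynomial σ ℂ, ∀ x : σ → ℂ, eval (fun j => eval x (F j)) q = x i := by
  obtain ⟨r, s, hs, hrs⟩ := exists_X_mul_bind₁_eq F hF i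
  obtain ⟨r', s', c, hrel, rfl, rfl⟩ := UniqueFactorizationMonoid.exists_reduced_factors' r s hs
  have hc : bind₁ F c ≠ 0 := by
    intro h0
    refine left_ne_zero_of_mul hs ((algebraicIndependent_iff.1
      (algebraicIndependent_of_surjective F hF.2)) c h0)
  have h1 : X i * bind₁ F s' = bind₁ F r' := by
    refine mul_left_cancel₀ hc ?_
    rw [map_mul, map_mul] at hrs
    rw [← hrs]
    ring
  have hev : ∀ (x : σ → ℂ) (p : MvPolynomial σ ℂ),
      eval x (bind₁ F p) = eval (fun j => eval x (F j)) p := by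
    intro x p
    simp only [← coe_aeval_eq_eval, RingHom.coe_coe]
    exact comp_aeval_apply F (aeval x) p
  have h2 : ∀ x : σ → ℂ, x i * eval (fun j => eval x (F j)) s' =
      eval (fun j => eval x (F j)) r' := by
    intro x
    rw [← hev, ← hev, ← h1, map_mul, eval_X]
  -- The fraction `r' / s'` is reduced. At a zero `y = F x` of an irreducible factor `p` of `s'`,
  -- the relation `x i * s' y = r' y` forces `r' y = 0`; by the Nullstellensatz `p` divides a power
  -- of `r'`, a contradiction.
  have hunit : IsUnit s' := by
    by_contra hnu
    obtain ⟨p, hp, hps⟩ := WfDvdMonoid.exists_irreducible_factor hnu (right_ne_zero_of_mul hs)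
    have hr : r' ∈ (Ideal.span {p}).radical := by
      rw [← vanishingIdeal_zeroLocus_eq_radical (K := ℂ), mem_vanishingIdeal_iff]
      intro y hy
      have hpy : eval y p = 0 := by
        simpa [coe_aeval_eq_eval] using hy p (Ideal.mem_span_singleton_self p)
      obtain ⟨x, rfl⟩ := hF.2 y
      obtain ⟨t, rfl⟩ := hps
      have h3 := h2 x
      rw [map_mul, hpy, zero_mul, mul_zero] at h3
      simpa [coe_aeval_eq_eval] using h3.symm
    obtain ⟨e, he⟩ := hr
    exact hp.not_isUnit (hrel (hp.prime.dvd_of_dvd_pow (Ideal.mem_span_singleton.1 he)) hps)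
  obtain ⟨t, ht⟩ := hunit.exists_right_inv
  refine ⟨r' * t, fun x => ?_⟩
  have h4 := congrArg (eval fun j => eval x (F j)) ht
  rw [map_mul, map_one] at h4
  rw [map_mul, ← h2, mul_assoc, h4, mul_one]

end PolynomialInverse

/-! ### Calculus of polynomial maps -/

section PolynomialMaps

open MvPolynomial

theorem IsPolynomialMap.comp {n m l : ℕ} {g : (Fin m → ℂ) → (Fin l → ℂ)}
    {f : (Fin n → ℂ) → (Fin m → ℂ)} (hg : IsPolynomialMap g) (hf : IsPolynomialMap f) :
    IsPolynomialMap fun x => g (f x) := by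
  obtain ⟨p, hp⟩ := hg
  obtain ⟨q, hq⟩ := hf
  refine ⟨fun i => bind₁ q (p i), fun x i => ?_⟩
  change g (f x) i = eval x (bind₁ q (p i))
  rw [hp, ← coe_aeval_eq_eval, ← coe_aeval_eq_eval, RingHom.coe_coe, RingHom.coe_coe]
  have h : f x = fun j => aeval x (q j) := by
    refine _root_.funext fun j => ?_
    rw [hq, ← coe_aeval_eq_eval, RingHom.coe_coe]
  rw [h]
  exact (comp_aeval_apply q (aeval x) (p i)).symm

theorem IsPolynomialMap.add {n m : ℕ} {f g : (Fin n → ℂ) → (Fin m → ℂ)} (hf : IsPolynomialMap f)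
    (hg : IsPolynomialMap g) : IsPolynomialMap fun x => f x + g x := by
  obtain ⟨p, hp⟩ := hf
  obtain ⟨q, hq⟩ := hg
  exact ⟨p + q, fun x i => by simp [hp, hq]⟩

theorem IsPolynomialMap.mulVec {n m : ℕ} (M : Matrix (Fin m) (Fin n) ℂ) :
    IsPolynomialMap fun x => M *ᵥ x :=
  ⟨fun i => ∑ j, C (M i j) * X j, fun x i => by simp [Matrix.mulVec, dotProduct]⟩

theorem isPolynomialMap_cubicLinear {N : ℕ} (A : Matrix (Fin N) (Fin N) ℂ) :
    IsPolynomialMap (cubicLinear A) :=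
  ⟨fun i => X i - (∑ j, C (A i j) * X j) ^ 3,
    fun x i => by simp [cubicLinear, Matrix.mulVec, dotProduct]⟩

theorem Paired.isPolynomialMap {n N : ℕ} {f : (Fin n → ℂ) → (Fin n → ℂ)}
    {A : Matrix (Fin N) (Fin N) ℂ} {B : Matrix (Fin n) (Fin N) ℂ} {C : Matrix (Fin N) (Fin n) ℂ}
    (h : Paired f A B C) : IsPolynomialMap f := by
  rw [show f = fun x => B *ᵥ cubicLinear A (C *ᵥ x) from _root_.funext h.apply_eq]
  exact (IsPolynomialMap.mulVec B).comp ((isPolynomialMap_cubicLinear A).comp (.mulVec C))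

theorem IsPolynomialMap.analyticOnNhd {n m : ℕ} {f : (Fin n → ℂ) → (Fin m → ℂ)}
    (hf : IsPolynomialMap f) : AnalyticOnNhd ℂ f Set.univ := by
  obtain ⟨p, hp⟩ := hf
  rw [show f = fun x i => eval x (p i) from _root_.funext fun x => _root_.funext (hp x)]
  exact fun x _ => analyticAt_pi_iff.2 fun i => AnalyticOnNhd.eval_mvPolynomial (p i) x trivial

theorem IsInverse.bijective {α β : Type*} {g : β → α} {f : α → β} (h : IsInverse g f) :
    Function.Bijective f :=
  ⟨h.1.injective, h.2.surjective⟩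

theorem IsInverse.symm {α β : Type*} {g : β → α} {f : α → β} (h : IsInverse g f) :
    IsInverse f g :=
  ⟨h.2, h.1⟩

theorem IsPolynomialMap.of_isInverse {n : ℕ} {f g : (Fin n → ℂ) → (Fin n → ℂ)}
    (hf : IsPolynomialMap f) (h : IsInverse g f) : IsPolynomialMap g := by
  obtain ⟨p, hp⟩ := hf
  have hfp : (fun x j => eval x (p j)) = f :=
    _root_.funext fun x => _root_.funext fun j => (hp x j).symm
  choose q hq using MvPolynomial.exists_eval_eq_of_bijective p (hfp ▸ h.bijective)
  refine ⟨q, fun y i => ?_⟩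
  have h1 := hq i (g y)
  rw [← h1, show (fun j => eval (g y) (p j)) = y from (congrFun hfp (g y)).trans (h.2 y)]

theorem IsPolynomialMap.hasPolynomialInverse_iff {n : ℕ} {f : (Fin n → ℂ) → (Fin n → ℂ)}
    (hf : IsPolynomialMap f) : HasPolynomialInverse f ↔ Function.Bijective f := by
  refine ⟨fun ⟨g, hg, _⟩ => hg.bijective, fun h => ?_⟩
  obtain ⟨g, hg⟩ := Function.bijective_iff_has_inverse.1 h
  exact ⟨g, hg, hf.of_isInverse hg⟩

/-- The inverse is itself a polynomial bijection, so its own inverse is polynomial. -/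
theorem HasPolynomialInverse.isPolynomialMap {n : ℕ} {f : (Fin n → ℂ) → (Fin n → ℂ)}
    (h : HasPolynomialInverse f) : IsPolynomialMap f := by
  obtain ⟨g, hg, hp⟩ := h
  exact hp.of_isInverse hg.symm

end PolynomialMaps

/-! ### Analyticity of cubic forms -/

section TrilinearAnalysis

open Filter Topology

variable {E : Type*} [NormedAddCommGroup E] [NormedSpace ℂ E] [CompleteSpace E]

theorem ContinuousMultilinearMap.analyticAt_diag
    (T : ContinuousMultilinearMap ℂ (fun _ : Fin 3 => E) E) (x : E) :
    AnalyticAt ℂ (fun v => T fun _ => v) x := by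
  have h1 : AnalyticAt ℂ T (fun _ => x) :=
    T.hasFiniteFPowerSeriesOnBall.toHasFPowerSeriesOnBall.analyticAt_of_mem (by simp)
  exact h1.comp (f := fun v : E => fun _ : Fin 3 => v)
    ((ContinuousLinearMap.pi fun _ : Fin 3 => ContinuousLinearMap.id ℂ E).analyticAt x)

theorem ContinuousMultilinearMap.hasStrictFDerivAt_diag
    (T : ContinuousMultilinearMap ℂ (fun _ : Fin 3 => E) E) :
    HasStrictFDerivAt (fun v => T fun _ => v) (0 : E →L[ℂ] E) 0 := by
  have h : HasFDerivAt (fun v => T fun _ => v) (0 : E →L[ℂ] E) 0 := by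
    refine Asymptotics.IsBigO.hasFDerivAt (n := 3) ?_ (by norm_num)
    refine Asymptotics.IsBigO.of_bound ‖T‖ (Eventually.of_forall fun v => ?_)
    simpa using T.le_opNorm fun _ => v
  have h2 := (T.analyticAt_diag 0).hasStrictFDerivAt
  rwa [h.fderiv] at h2

end TrilinearAnalysis

/-! ### Uniqueness of conjugations -/

section LocalUniqueness

open Filter Topology Asymptotics

variable {E : Type*} [NormedAddCommGroup E] [NormedSpace ℂ E]

/-- A curve `φ` with `φ (lam t) = lam φ t + o(φ t)`, vanishing to second order, is zero. -/
theorem eventually_eq_zero_of_isLittleO {lam : ℂ} (h0 : lam ≠ 0) (h1 : ‖lam‖ ≠ 1) {φ : ℂ → E}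
    (hφ : AnalyticAt ℂ φ 0) (hz : φ 0 = 0) (hd : deriv φ 0 = 0)
    (ho : (fun t => φ (lam * t) - lam • φ t) =o[𝓝 0] φ) : ∀ᶠ t in 𝓝 0, φ t = 0 := by
  by_contra hne
  -- Factor `φ t = t ^ d • ψ t` with `ψ 0 ≠ 0`. The hypotheses give `d ≥ 2`, and comparing leading
  -- terms gives `lam ^ d = lam`, impossible for `‖lam‖ ≠ 1`.
  obtain ⟨d, ψ, hψ, hψ0, heq⟩ := hφ.exists_eventuallyEq_pow_smul_nonzero_iff.2 hne
  simp only [sub_zero] at heq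
  have hd0 : d ≠ 0 := by
    rintro rfl
    have := heq.self_of_nhds
    rw [hz, pow_zero, one_smul] at this
    exact hψ0 this.symm
  have hd1 : d ≠ 1 := by
    rintro rfl
    have hder : HasDerivAt (fun t : ℂ => t ^ 1 • ψ t)
        ((0 : ℂ) ^ 1 • deriv ψ 0 + (1 : ℂ) • ψ 0) 0 := by
      simpa using (hasDerivAt_id (0 : ℂ)).fun_smul hψ.differentiableAt.hasDerivAt
    have h2 := (hder.congr_of_eventuallyEq heq).deriv
    rw [hd] at h2
    simp at h2
    exact hψ0 h2.symm
  have hlt : Tendsto (fun t => lam * t) (𝓝 0) (𝓝 0) := by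
    have : Continuous fun t : ℂ => lam * t := by fun_prop
    simpa using this.tendsto 0
  have heq' : ∀ᶠ t in 𝓝 0, φ (lam * t) = (lam * t) ^ d • ψ (lam * t) := hlt.eventually heq
  let a : ℂ → E := fun t => lam ^ d • ψ (lam * t) - lam • ψ t
  have hao : a =o[𝓝[≠] 0] ψ := by
    rw [isLittleO_iff] at ho ⊢
    intro c hc
    filter_upwards [(ho hc).filter_mono nhdsWithin_le_nhds, heq.filter_mono nhdsWithin_le_nhds,
      heq'.filter_mono nhdsWithin_le_nhds, self_mem_nhdsWithin] with t ht h3 h4 htne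
    have hpos : 0 < ‖t ^ d‖ := norm_pos_iff.2 (pow_ne_zero d htne)
    have h5 : φ (lam * t) - lam • φ t = t ^ d • a t := by
      simp only [a]
      rw [h3, h4, mul_pow, smul_sub, smul_smul, smul_smul, smul_smul, mul_comm (lam ^ d),
        mul_comm lam (t ^ d)]
    rw [h5, h3, norm_smul, norm_smul, mul_left_comm] at ht
    exact le_of_mul_le_mul_left ht hpos
  have hψc : Tendsto ψ (𝓝[≠] 0) (𝓝 (ψ 0)) := hψ.continuousAt.tendsto.mono_left nhdsWithin_le_nhds
  have ha0 : Tendsto a (𝓝[≠] 0) (𝓝 0) :=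
    (hao.trans_isBigO (hψc.isBigO_one ℂ)).tendsto_zero_of_tendsto tendsto_const_nhds
  have ha1 : Tendsto a (𝓝[≠] 0) (𝓝 (lam ^ d • ψ 0 - lam • ψ 0)) := by
    have hψl : Tendsto (fun t => ψ (lam * t)) (𝓝 0) (𝓝 (ψ 0)) := hψ.continuousAt.tendsto.comp hlt
    exact ((hψl.mono_left nhdsWithin_le_nhds).const_smul _).sub (hψc.const_smul _)
  have h6 := tendsto_nhds_unique ha1 ha0
  rw [← sub_smul, smul_eq_zero, or_iff_left hψ0, sub_eq_zero] at h6
  obtain ⟨e, rfl⟩ : ∃ e, d = e + 2 := ⟨d - 2, by omega⟩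
  have h7 : lam ^ (e + 1) = 1 := mul_right_cancel₀ h0 (by rw [← pow_succ, one_mul]; exact h6)
  have h8 : ‖lam‖ ^ (e + 1) = 1 := by rw [← norm_pow, h7, norm_one]
  exact h1 ((pow_eq_one_iff_of_nonneg (norm_nonneg _) (by omega)).1 h8)

/-- Two local conjugations of `f` to `lam • id`, tangent to the identity, agree on balls. -/
theorem eqOn_ball_of_local_conj [CompleteSpace E] {lam : ℂ} (h0 : lam ≠ 0) (h1 : ‖lam‖ ≠ 1)
    {f : E → E} (hf : HasStrictFDerivAt f (ContinuousLinearMap.id ℂ E) 0) {ρ : ℝ} {k l : E → E}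
    (hk : AnalyticOnNhd ℂ k (Metric.ball 0 ρ)) (hl : AnalyticOnNhd ℂ l (Metric.ball 0 ρ))
    (hk0 : k 0 = 0) (hl0 : l 0 = 0) (hkd : HasFDerivAt k (ContinuousLinearMap.id ℂ E) 0)
    (hld : HasFDerivAt l (ContinuousLinearMap.id ℂ E) 0)
    (hkc : ∀ᶠ y in 𝓝 0, lam • f (k y) = k (lam • y))
    (hlc : ∀ᶠ y in 𝓝 0, lam • f (l y) = l (lam • y)) : Set.EqOn k l (Metric.ball 0 ρ) := by
  intro y hy
  have hρ : 0 < ρ := Metric.pos_of_mem_ball hy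
  -- Restriction to the complex line through `y` reduces the claim to one variable.
  let ℓ : ℂ →L[ℂ] E := (ContinuousLinearMap.id ℂ ℂ).smulRight y
  have hℓ : ∀ t, ℓ t = t • y := fun t => rfl
  let D : Set ℂ := ℓ ⁻¹' Metric.ball 0 ρ
  have hDc : Convex ℝ D :=
    (convex_ball (0 : E) ρ).linear_preimage (ℓ.toLinearMap.restrictScalars ℝ)
  let φ : ℂ → E := fun t => k (ℓ t) - l (ℓ t)
  have hφ : AnalyticOnNhd ℂ φ D := fun t ht =>
    ((hk _ ht).comp (ℓ.analyticAt t)).sub ((hl _ ht).comp (ℓ.analyticAt t))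
  have h0D : (0 : ℂ) ∈ D := by simp [D, hρ]
  have h1D : (1 : ℂ) ∈ D := by simpa [D, hℓ] using hy
  have hℓt : Tendsto ℓ (𝓝 0) (𝓝 0) := by simpa using ℓ.continuous.tendsto 0
  have hev : ∀ᶠ t in 𝓝 0, φ t = 0 := by
    refine eventually_eq_zero_of_isLittleO h0 h1 (hφ 0 h0D) (by simp [φ, hk0, hl0]) ?_ ?_
    · have e1 : HasFDerivAt k (ContinuousLinearMap.id ℂ E) (ℓ 0) := by simpa using hkd
      have e2 : HasFDerivAt l (ContinuousLinearMap.id ℂ E) (ℓ 0) := by simpa using hld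
      have e3 := ((e1.comp (0 : ℂ) ℓ.hasFDerivAt).sub (e2.comp (0 : ℂ) ℓ.hasFDerivAt)).hasDerivAt
      have e4 := e3.deriv
      simp only [sub_self, _root_.zero_apply] at e4
      exact e4
    · have hkt : Tendsto k (𝓝 0) (𝓝 0) := by simpa [hk0] using hkd.continuousAt.tendsto
      have hlt : Tendsto l (𝓝 0) (𝓝 0) := by simpa [hl0] using hld.continuousAt.tendsto
      have ht : Tendsto (fun t => (k (ℓ t), l (ℓ t))) (𝓝 0) (𝓝 ((0 : E), (0 : E))) :=
        (hkt.comp hℓt).prodMk_nhds (hlt.comp hℓt)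
      -- Strict differentiability is what bounds `f (k) - f (l) - (k - l)` by `o(k - l)`.
      have ho := (hf.isLittleO.comp_tendsto ht).const_smul_left lam
      refine ho.congr' ?_ (Eventually.of_forall fun t => rfl)
      filter_upwards [hℓt.eventually hkc, hℓt.eventually hlc] with t h3 h4
      have h5 : ℓ (lam * t) = lam • ℓ t := by rw [← smul_eq_mul, map_smul]
      simp only [φ, h5, ← h3, ← h4, Pi.smul_apply, Function.comp_apply,
        ContinuousLinearMap.id_apply, smul_sub]
  have h2 := hφ.eqOn_zero_of_preconnected_of_eventuallyEq_zero hDc.isPreconnected h0D hev h1D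
  simpa [φ, hℓ, sub_eq_zero] using h2

end LocalUniqueness

/-! ### Global extension by a functional equation -/

section Extension

open Filter Topology

variable {E F : Type*} [NormedAddCommGroup E] [NormedSpace ℂ E]
  [NormedAddCommGroup F] [NormedSpace ℂ F] [CompleteSpace F]

/-- A germ satisfying a functional equation that contracts the source extends to all of `E`. -/
theorem exists_analytic_extension {r : ℂ} (hr : ‖r‖ < 1) {S : E → F → F}
    (hS : ∀ p : E × F, AnalyticAt ℂ (fun p : E × F => S p.1 p.2) p) {U : E → F}
    (hU : AnalyticAt ℂ U 0) (heq : ∀ᶠ y in 𝓝 0, U y = S y (U (r • y))) :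
    ∃ V : E → F, AnalyticOnNhd ℂ V Set.univ ∧ V =ᶠ[𝓝 0] U ∧ ∀ y, V y = S y (V (r • y)) := by
  obtain ⟨ε, hε, hball⟩ : ∃ ε > 0, ∀ y ∈ Metric.ball (0 : E) ε,
      AnalyticAt ℂ U y ∧ U y = S y (U (r • y)) :=
    Metric.eventually_nhds_iff_ball.1 (hU.eventually_analyticAt.and heq)
  -- Each application of the equation enlarges the domain by the factor `1 / ‖r‖`: `W m` is analytic
  -- on `D m`, the iterates agree on overlaps, and the `D m` exhaust `E`.
  let W : ℕ → E → F := fun m => Nat.rec U (fun _ w y => S y (w (r • y))) m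
  have hWs : ∀ m y, W (m + 1) y = S y (W m (r • y)) := fun m y => rfl
  let D : ℕ → Set E := fun m => {y | ‖r‖ ^ m * ‖y‖ < ε}
  have hDs : ∀ m y, y ∈ D (m + 1) → r • y ∈ D m := by
    intro m y hy
    simp only [D, Set.mem_ofPred_eq, norm_smul] at hy ⊢
    rwa [← mul_assoc, ← pow_succ]
  have hDmono : Monotone D := by
    refine monotone_nat_of_le_succ fun m y hy => ?_
    simp only [D, Set.mem_ofPred_eq] at hy ⊢
    refine lt_of_le_of_lt ?_ hy
    exact mul_le_mul_of_nonneg_right (pow_le_pow_of_le_one (norm_nonneg _) hr.le m.le_succ)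
      (norm_nonneg _)
  have hD0 : ∀ y, y ∈ D 0 → y ∈ Metric.ball (0 : E) ε := by
    intro y hy
    simpa [D] using hy
  have hDo : ∀ m, IsOpen (D m) := fun m =>
    isOpen_lt (by fun_prop) continuous_const
  have hWan : ∀ m, AnalyticOnNhd ℂ (W m) (D m) := by
    intro m
    induction m with
    | zero => exact fun y hy => (hball y (hD0 y hy)).1
    | succ m ih =>
      intro y hy
      have e1 : AnalyticAt ℂ (fun y => W m (r • y)) y :=
        (ih _ (hDs m y hy)).comp (f := fun y => r • y) (analyticAt_const.smul analyticAt_id)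
      exact (hS (y, W m (r • y))).comp (f := fun y => (y, W m (r • y))) (analyticAt_id.prod e1)
  have hWeq : ∀ m, Set.EqOn (W (m + 1)) (W m) (D m) := by
    intro m
    induction m with
    | zero => exact fun y hy => (hball y (hD0 y hy)).2.symm
    | succ m ih =>
      intro y hy
      rw [hWs (m + 1) y, hWs m y, ih (hDs m y hy)]
  have hWle : ∀ m j, Set.EqOn (W (m + j)) (W m) (D m) := by
    intro m j
    induction j with
    | zero => exact fun y _ => rfl
    | succ j ih => exact fun y hy => (hWeq (m + j) (hDmono (m.le_add_right j) hy)).trans (ih hy)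
  have hex : ∀ y, ∃ m, y ∈ D m := by
    intro y
    have ht : Tendsto (fun m : ℕ => ‖r‖ ^ m * ‖y‖) atTop (𝓝 0) := by
      simpa using (tendsto_pow_atTop_nhds_zero_of_lt_one (norm_nonneg r) hr).mul_const ‖y‖
    exact (ht.eventually (gt_mem_nhds hε)).exists
  choose M hM using hex
  let V : E → F := fun y => W (M y) y
  have hV : ∀ m, Set.EqOn V (W m) (D m) := by
    intro m y hy
    rcases le_total m (M y) with h | h
    · obtain ⟨j, hj⟩ := Nat.exists_eq_add_of_le h
      simp only [V]
      rw [hj]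
      exact hWle m j hy
    · obtain ⟨j, hj⟩ := Nat.exists_eq_add_of_le h
      rw [hj]
      exact (hWle (M y) j (hM y)).symm
  refine ⟨V, fun y _ => ?_, ?_, fun y => ?_⟩
  · exact (hWan _ y (hM y)).congr ((hV _).eventuallyEq_of_mem ((hDo _).mem_nhds (hM y))).symm
  · exact (hV 0).eventuallyEq_of_mem ((hDo 0).mem_nhds (by simpa [D] using hε))
  · have h1 := hDmono (M y).le_succ (hM y)
    rw [hV _ h1, hWs, hV _ (hDs _ _ h1)]

end Extension

/-! ### Local solutions through bounded sequences -/

section SequenceSpace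

open Filter Topology BoundedContinuousFunction

variable {E : Type*} [NormedAddCommGroup E] [NormedSpace ℂ E]

/-- Constant sequences, as a continuous linear map. -/
noncomputable def constSeq (E : Type*) [NormedAddCommGroup E] [NormedSpace ℂ E] :
    E →L[ℂ] (ℕ →ᵇ E) :=
  LinearMap.mkContinuous
    { toFun := fun y => BoundedContinuousFunction.const ℕ y
      map_add' := fun _ _ => rfl
      map_smul' := fun _ _ => rfl } 1
    fun y => by
      rw [one_mul]
      exact norm_const_le y

theorem constSeq_apply (y : E) (m : ℕ) : constSeq E y m = y := rfl

/-- The scaled shift `(v m) ↦ (r • v (m + 1))`. -/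
noncomputable def scaledShift (E : Type*) [NormedAddCommGroup E] [NormedSpace ℂ E] (r : ℂ) :
    (ℕ →ᵇ E) →L[ℂ] (ℕ →ᵇ E) :=
  r • LinearMap.mkContinuous
    { toFun := fun v => v.compContinuous ⟨Nat.succ, continuous_of_discreteTopology⟩
      map_add' := fun _ _ => rfl
      map_smul' := fun _ _ => rfl } 1
    fun v => by
      rw [one_mul]
      exact (norm_le (norm_nonneg v)).2 fun m => v.norm_coe_le_norm _

theorem scaledShift_apply (r : ℂ) (v : ℕ →ᵇ E) (m : ℕ) : scaledShift E r v m = r • v (m + 1) :=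
  rfl

theorem scaledShift_constSeq (r : ℂ) (y : E) :
    scaledShift E r (constSeq E y) = constSeq E (r • y) := rfl

theorem scaledShift_pow_apply (r : ℂ) (v : ℕ →ᵇ E) (s m : ℕ) :
    (scaledShift E r)^[s] v m = r ^ s • v (m + s) := by
  induction s generalizing m with
  | zero => simp
  | succ s ih =>
    rw [Function.iterate_succ_apply', scaledShift_apply, ih, smul_smul, pow_succ', add_right_comm]
    rfl

variable (g : ContinuousMultilinearMap ℂ (fun _ : Fin 3 => E) E)

theorem norm_trilinearSum_term_le (r : ℂ) (s : ℕ) (v : Fin 3 → (ℕ →ᵇ E)) (hr : ‖r‖ < 1)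
    (m j : ℕ) : ‖r ^ (2 * (m + j)) • g (fun i => v i (m + j + s))‖ ≤
      ‖r‖ ^ j * (‖g‖ * ∏ i, ‖v i‖) := by
  rw [norm_smul, norm_pow]
  refine mul_le_mul (pow_le_pow_of_le_one (norm_nonneg _) hr.le (by omega)) ?_ (norm_nonneg _)
    (by positivity)
  refine (g.le_opNorm _).trans ?_
  gcongr with i
  exact (v i).norm_coe_le_norm _

theorem summable_trilinearSum [CompleteSpace E] (r : ℂ) (s : ℕ) (v : Fin 3 → (ℕ →ᵇ E))
    (hr : ‖r‖ < 1) (m : ℕ) :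
    Summable fun j => r ^ (2 * (m + j)) • g (fun i => v i (m + j + s)) :=
  Summable.of_norm_bounded
    ((summable_geometric_of_lt_one (norm_nonneg r) hr).mul_right _)
    (norm_trilinearSum_term_le g r s v hr m)

theorem norm_trilinearSum_le (r : ℂ) (s : ℕ) (v : Fin 3 → (ℕ →ᵇ E)) (hr : ‖r‖ < 1) (m : ℕ) :
    ‖∑' j, r ^ (2 * (m + j)) • g (fun i => v i (m + j + s))‖ ≤
      ((1 - ‖r‖)⁻¹ * ‖g‖) * ∏ i, ‖v i‖ := by
  rw [mul_assoc]
  exact tsum_of_norm_bounded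
    ((hasSum_geometric_of_lt_one (norm_nonneg r) hr).mul_right _)
    (norm_trilinearSum_term_le g r s v hr m)

variable [CompleteSpace E]

/-- The trilinear map on bounded sequences whose `m`-th entry is
`∑ j, r ^ (2 (m + j)) g (v (m + j + s))`. -/
noncomputable def trilinearSum (r : ℂ) (s : ℕ) (hr : ‖r‖ < 1) :
    ContinuousMultilinearMap ℂ (fun _ : Fin 3 => (ℕ →ᵇ E)) (ℕ →ᵇ E) :=
  MultilinearMap.mkContinuous
    { toFun := fun v => BoundedContinuousFunction.ofNormedAddCommGroupDiscrete
        (fun m => ∑' j, r ^ (2 * (m + j)) • g (fun i => v i (m + j + s))) _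
        (norm_trilinearSum_le g r s v hr)
      map_update_add' := by
        intro _ v i x y
        ext m
        have hup : ∀ (z : ℕ →ᵇ E) (l : ℕ), (fun i' => Function.update v i z i' l) =
            Function.update (fun i' => v i' l) i (z l) := by
          intro z l
          funext i'
          by_cases h : i' = i
          · subst h; simp
          · simp [h]
        simp only [BoundedContinuousFunction.coe_add, Pi.add_apply,
          BoundedContinuousFunction.coe_ofNormedAddCommGroupDiscrete]
        rw [← (summable_trilinearSum g r s _ hr m).tsum_add (summable_trilinearSum g r s _ hr m)]
        refine tsum_congr fun j => ?_
        rw [← smul_add]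
        simp only [hup, BoundedContinuousFunction.coe_add, Pi.add_apply, g.map_update_add]
      map_update_smul' := by
        intro _ v i c x
        ext m
        have hup : ∀ (z : ℕ →ᵇ E) (l : ℕ), (fun i' => Function.update v i z i' l) =
            Function.update (fun i' => v i' l) i (z l) := by
          intro z l
          funext i'
          by_cases h : i' = i
          · subst h; simp
          · simp [h]
        simp only [BoundedContinuousFunction.coe_smul,
          BoundedContinuousFunction.coe_ofNormedAddCommGroupDiscrete]
        rw [← (summable_trilinearSum g r s _ hr m).tsum_const_smul]
        refine tsum_congr fun j => ?_
        rw [smul_comm c]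
        simp only [hup, BoundedContinuousFunction.coe_smul, g.map_update_smul] }
    ((1 - ‖r‖)⁻¹ * ‖g‖) fun v => by
      have : 0 ≤ (1 - ‖r‖)⁻¹ := inv_nonneg.2 (by linarith)
      exact (norm_le (by positivity)).2 (norm_trilinearSum_le g r s v hr)

theorem trilinearSum_apply (r : ℂ) (s : ℕ) (hr : ‖r‖ < 1) (v : Fin 3 → (ℕ →ᵇ E)) (m : ℕ) :
    trilinearSum g r s hr v m = ∑' j, r ^ (2 * (m + j)) • g (fun i => v i (m + j + s)) := rfl

/-- The two series telescope, leaving only the first term of the entry at `0`. -/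
theorem trilinearSum_zero_sub_one (r : ℂ) (s : ℕ) (hr : ‖r‖ < 1) (v : Fin 3 → (ℕ →ᵇ E)) :
    trilinearSum g r s hr v 0 - trilinearSum g r s hr v 1 = g fun i => v i s := by
  rw [trilinearSum_apply, trilinearSum_apply,
    (summable_trilinearSum g r s v hr 0).tsum_eq_zero_add, sub_eq_iff_eq_add]
  congr 1
  · simp
  · refine tsum_congr fun j => ?_
    rw [show 0 + (j + 1) = 1 + j by omega]

/-- Trilinearity produces `r ^ 3`: one factor is the scaling of the shift, the other two advance the
weight `r ^ (2 (m + j))` by one index. -/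
theorem trilinearSum_scaledShift (r : ℂ) (s : ℕ) (hr : ‖r‖ < 1) (v : ℕ →ᵇ E) :
    trilinearSum g r s hr (fun _ => scaledShift E r v) =
      scaledShift E r (trilinearSum g r s hr fun _ => v) := by
  ext m
  rw [scaledShift_apply, trilinearSum_apply, trilinearSum_apply,
    ← (summable_trilinearSum g r s _ hr _).tsum_const_smul]
  refine tsum_congr fun j => ?_
  simp only [scaledShift_apply]
  rw [g.map_smul_univ (fun _ => r), Finset.prod_const, Finset.card_univ, Fintype.card_fin,
    smul_smul, smul_smul, show m + j + s + 1 = m + 1 + j + s by omega]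
  congr 1
  ring

/-- Local solutions of the functional equations `V y - V (r y) / r = g (V (r ^ s y) / r ^ s)`,
obtained from the inverse function theorem in the space of bounded sequences. -/
theorem exists_local_solution {r : ℂ} (hr0 : r ≠ 0) (hr : ‖r‖ < 1) (s : ℕ) :
    ∃ V : E → E, AnalyticAt ℂ V 0 ∧ V 0 = 0 ∧ HasFDerivAt V (ContinuousLinearMap.id ℂ E) 0 ∧
      ∀ᶠ y in 𝓝 0, V y - r⁻¹ • V (r • y) = g fun _ => (r ^ s)⁻¹ • V (r ^ s • y) := by
  -- For a solution `V`, put `v m = V (r ^ m y) / r ^ m`. The equation at `r ^ m y` reads `v m - v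
  -- (m + 1) = r ^ (2 m) g (v (m + s))`, and `v m → y`; summing gives `v - T v = constSeq y`.
  let T := trilinearSum g r s hr
  let Φ : (ℕ →ᵇ E) → (ℕ →ᵇ E) := fun v => v - T fun _ => v
  have hΦ : HasStrictFDerivAt Φ
      ((ContinuousLinearEquiv.refl ℂ (ℕ →ᵇ E) : (ℕ →ᵇ E) ≃L[ℂ] (ℕ →ᵇ E)) :
        (ℕ →ᵇ E) →L[ℂ] (ℕ →ᵇ E)) 0 := by
    refine ((hasStrictFDerivAt_id 0).sub T.hasStrictFDerivAt_diag).congr_fderiv ?_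
    rw [sub_zero]
    rfl
  have hΦan : AnalyticAt ℂ Φ 0 := analyticAt_id.sub (T.analyticAt_diag 0)
  have hΦ0 : Φ 0 = 0 := by
    have : T (fun _ => 0) = 0 := T.map_zero
    simp [Φ, this]
  let R := hΦ.toOpenPartialHomeomorph Φ
  have hΨan : AnalyticAt ℂ R.symm 0 := by
    have h := R.analyticAt_symm' (i := ContinuousLinearEquiv.refl ℂ (ℕ →ᵇ E))
      hΦ.mem_toOpenPartialHomeomorph_source hΦan hΦ.hasFDerivAt.fderiv
    rwa [show R 0 = 0 from hΦ0] at h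
  have hΨd : HasStrictFDerivAt R.symm
      (((ContinuousLinearEquiv.refl ℂ (ℕ →ᵇ E)).symm : (ℕ →ᵇ E) ≃L[ℂ] (ℕ →ᵇ E)) :
        (ℕ →ᵇ E) →L[ℂ] (ℕ →ᵇ E)) 0 := by
    have h := hΦ.to_localInverse
    rwa [hΦ0] at h
  have hΨ0 : R.symm 0 = 0 := by
    have h := hΦ.localInverse_apply_image
    rwa [hΦ0] at h
  have hleft : ∀ᶠ v in 𝓝 0, R.symm (Φ v) = v := hΦ.eventually_left_inverse
  have hright : ∀ᶠ w in 𝓝 0, Φ (R.symm w) = w := by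
    have h := hΦ.eventually_right_inverse
    rwa [hΦ0] at h
  have hcomm : ∀ v, Φ (scaledShift E r v) = scaledShift E r (Φ v) := by
    intro v
    simp only [Φ, T, trilinearSum_scaledShift, map_sub]
  let κ : E → (ℕ →ᵇ E) := fun y => R.symm (constSeq E y)
  have hc0 : constSeq E (0 : E) = 0 := map_zero _
  have hκan : AnalyticAt ℂ κ 0 :=
    AnalyticAt.comp (g := R.symm) (by rwa [hc0]) ((constSeq E).analyticAt 0)
  have hκd : HasFDerivAt κ (constSeq E) 0 := by
    have h1 := hΨd.hasFDerivAt
    rw [← hc0] at h1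
    exact h1.comp 0 (constSeq E).hasFDerivAt
  have hκ0 : κ 0 = 0 := by simp only [κ, hc0, hΨ0]
  have hct : Tendsto (constSeq E) (𝓝 0) (𝓝 0) := by
    simpa using (constSeq E).continuous.tendsto 0
  have hκt : Tendsto κ (𝓝 0) (𝓝 0) := by simpa [hκ0] using hκd.continuousAt.tendsto
  have hst : Tendsto (scaledShift E r) (𝓝 0) (𝓝 0) := by
    simpa using (scaledShift E r).continuous.tendsto 0
  -- Equivariance under the shift shows that every entry of `κ y` comes from the zeroth entry at a
  -- contracted point, so that entry is the desired `V`.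
  have hev : ∀ᶠ y in 𝓝 0, Φ (κ y) = constSeq E y ∧ κ (r • y) = scaledShift E r (κ y) := by
    filter_upwards [hct.eventually hright, (hst.comp hκt).eventually hleft] with y h1 h2
    refine ⟨h1, ?_⟩
    simp only [Function.comp_apply] at h2
    rw [hcomm, h1, scaledShift_constSeq] at h2
    exact h2
  obtain ⟨ε, hε, hball⟩ := Metric.eventually_nhds_iff_ball.1 hev
  have hiter : ∀ j : ℕ, ∀ y ∈ Metric.ball (0 : E) ε,
      κ (r ^ j • y) = (scaledShift E r)^[j] (κ y) := by
    intro j y hy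
    induction j with
    | zero => simp
    | succ j ih =>
      have hmem : r ^ j • y ∈ Metric.ball (0 : E) ε := by
        rw [mem_ball_zero_iff, norm_smul, norm_pow] at *
        exact (mul_le_of_le_one_left (norm_nonneg _)
          (pow_le_one₀ (norm_nonneg _) hr.le)).trans_lt hy
      rw [pow_succ', ← smul_smul, (hball _ hmem).2, ih, Function.iterate_succ_apply']
  have hentry : ∀ j : ℕ, ∀ y ∈ Metric.ball (0 : E) ε, κ y j = (r ^ j)⁻¹ • κ (r ^ j • y) 0 := by
    intro j y hy
    rw [hiter j y hy, scaledShift_pow_apply, zero_add, inv_smul_smul₀ (pow_ne_zero j hr0)]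
  let ev : (ℕ →ᵇ E) →L[ℂ] E := evalCLM ℂ 0
  refine ⟨fun y => κ y 0, (ev.analyticAt _).comp hκan, by simp [hκ0],
    ev.hasFDerivAt.comp 0 hκd, ?_⟩
  filter_upwards [Metric.ball_mem_nhds (0 : E) hε] with y hy
  have h1 := (hball y hy).1
  have e : ∀ m, κ y m = y + T (fun _ => κ y) m := by
    intro m
    have h2 := congrArg (fun v : ℕ →ᵇ E => v m) h1
    simp only [Φ, constSeq_apply] at h2
    exact sub_eq_iff_eq_add.1 h2
  have h3 := hentry 1 y hy
  rw [pow_one] at h3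
  rw [← h3, ← hentry s y hy, e 0, e 1, add_sub_add_left_eq_sub]
  exact trilinearSum_zero_sub_one g r s hr fun _ => κ y

end SequenceSpace

/-! ### Pre-conjugations of cubic-homogeneous maps -/

section CubicHomogeneous

open Filter Topology

variable {n : ℕ} {f : (Fin n → ℂ) → (Fin n → ℂ)}

theorem MultilinearMap.continuous_of_pi
    (g : MultilinearMap ℂ (fun _ : Fin 3 => (Fin n → ℂ)) (Fin n → ℂ)) : Continuous g := by
  have h : ⇑g = fun v => ∑ p : Fin 3 → Fin n,
      (∏ l, v l (p l)) • g fun l => Pi.single (p l) (1 : ℂ) := by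
    funext v
    have hv : v = fun l => ∑ i, v l i • Pi.single i (1 : ℂ) :=
      funext fun l => pi_eq_sum_univ' (v l)
    conv_lhs => rw [hv]
    rw [g.map_sum]
    exact Finset.sum_congr rfl fun p _ =>
      g.map_smul_univ (fun l => v l (p l)) fun l => Pi.single (p l) (1 : ℂ)
  rw [h]
  fun_prop

theorem IsCubicHomogeneous.exists_continuous (hf : IsCubicHomogeneous f) :
    ∃ g : ContinuousMultilinearMap ℂ (fun _ : Fin 3 => (Fin n → ℂ)) (Fin n → ℂ),
      ∀ x, f x = x - g fun _ => x := by
  obtain ⟨g, -, hg⟩ := hf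
  exact ⟨⟨g, g.continuous_of_pi⟩, hg⟩

theorem IsCubicHomogeneous.analyticAt (hf : IsCubicHomogeneous f) (x : Fin n → ℂ) :
    AnalyticAt ℂ f x := by
  obtain ⟨g, hg⟩ := hf.exists_continuous
  rw [funext hg]
  exact analyticAt_id.sub (g.analyticAt_diag x)

theorem IsCubicHomogeneous.hasStrictFDerivAt (hf : IsCubicHomogeneous f) :
    HasStrictFDerivAt f (ContinuousLinearMap.id ℂ (Fin n → ℂ)) 0 := by
  obtain ⟨g, hg⟩ := hf.exists_continuous
  rw [funext hg]
  refine ((hasStrictFDerivAt_id 0).sub g.hasStrictFDerivAt_diag).congr_fderiv ?_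
  rw [sub_zero]

theorem IsCubicHomogeneous.exists_local_conj (hf : IsCubicHomogeneous f) {lam : ℂ} (h0 : lam ≠ 0)
    (h1 : ‖lam‖ ≠ 1) : ∃ k : (Fin n → ℂ) → (Fin n → ℂ), AnalyticAt ℂ k 0 ∧ k 0 = 0 ∧
      HasFDerivAt k (ContinuousLinearMap.id ℂ (Fin n → ℂ)) 0 ∧
      ∀ᶠ y in 𝓝 0, lam • f (k y) = k (lam • y) := by
  obtain ⟨g, hg⟩ := hf.exists_continuous
  rcases h1.lt_or_gt with h | h
  · obtain ⟨V, han, hV0, hVd, hV⟩ := exists_local_solution g h0 h 0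
    refine ⟨V, han, hV0, hVd, ?_⟩
    filter_upwards [hV] with y hy
    rw [pow_zero, inv_one, one_smul, one_smul] at hy
    rw [hg, ← hy, sub_sub_cancel, smul_inv_smul₀ h0]
  -- With `r = 1 / lam` and `s = 1`, the argument of `g` is `lam V (y / lam)`; the factor `-lam⁻²`
  -- turns its `lam ^ 3` into the required `-lam`.
  · obtain ⟨V, han, hV0, hVd, hV⟩ := exists_local_solution (-(lam⁻¹ ^ 2) • g) (inv_ne_zero h0)
      (by rw [norm_inv]; exact inv_lt_one_of_one_lt₀ h) 1
    refine ⟨V, han, hV0, hVd, ?_⟩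
    have ht : Tendsto (fun y : Fin n → ℂ => lam • y) (𝓝 0) (𝓝 0) := by
      have hc : Continuous fun y : Fin n → ℂ => lam • y := by fun_prop
      simpa using hc.tendsto 0
    filter_upwards [ht.eventually hV] with y hy
    rw [inv_inv, pow_one, inv_inv, inv_smul_smul₀ h0, _root_.smul_apply,
      g.map_smul_univ (fun _ => lam), Finset.prod_const, Finset.card_univ, Fintype.card_fin,
      smul_smul, sub_eq_iff_eq_add] at hy
    rw [hy, hg, smul_sub, show -(lam⁻¹ ^ 2) * lam ^ 3 = -lam by field_simp, neg_smul]
    abel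

theorem IsGlobalPreconjugation.eq_of_eventually_conj (hf : IsCubicHomogeneous f) {lam : ℂ}
    (h0 : lam ≠ 0) (h1 : ‖lam‖ ≠ 1) {k l : (Fin n → ℂ) → (Fin n → ℂ)}
    (hk : IsGlobalPreconjugation lam f k) (hl : AnalyticAt ℂ l 0) (hl0 : l 0 = 0)
    (hld : HasFDerivAt l (ContinuousLinearMap.id ℂ (Fin n → ℂ)) 0)
    (hlc : ∀ᶠ y in 𝓝 0, lam • f (l y) = l (lam • y)) : l =ᶠ[𝓝 0] k := by
  obtain ⟨ρ, hρ, hball⟩ := Metric.eventually_nhds_iff_ball.1 hl.eventually_analyticAt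
  have h := eqOn_ball_of_local_conj h0 h1 hf.hasStrictFDerivAt hball
    (fun y _ => hk.analytic y trivial) hl0 hk.map_zero hld hk.deriv_zero hlc
    (Eventually.of_forall hk.conj)
  exact h.eventuallyEq_of_mem (Metric.ball_mem_nhds 0 hρ)

theorem IsGlobalPreconjugation.eq (hf : IsCubicHomogeneous f) {lam : ℂ}
    (h0 : lam ≠ 0) (h1 : ‖lam‖ ≠ 1) {k l : (Fin n → ℂ) → (Fin n → ℂ)}
    (hk : IsGlobalPreconjugation lam f k) (hl : IsGlobalPreconjugation lam f l) : l = k :=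
  hl.analytic.eq_of_eventuallyEq hk.analytic <|
    hk.eq_of_eventually_conj hf h0 h1 (hl.analytic 0 trivial) hl.map_zero hl.deriv_zero
      (Eventually.of_forall hl.conj)

/-- A local conjugation solving a contracting functional equation extends to a global
pre-conjugation. -/
theorem exists_globalPreconjugation_of_extension {lam r : ℂ} (hr : ‖r‖ < 1)
    {S : (Fin n → ℂ) → (Fin n → ℂ) → (Fin n → ℂ)}
    (hS : ∀ p : (Fin n → ℂ) × (Fin n → ℂ), AnalyticAt ℂ (fun p : _ × _ => S p.1 p.2) p)
    {U : (Fin n → ℂ) → (Fin n → ℂ)} (hU : AnalyticAt ℂ U 0) (hU0 : U 0 = 0)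
    (hUd : HasFDerivAt U (ContinuousLinearMap.id ℂ (Fin n → ℂ)) 0)
    (heq : ∀ᶠ y in 𝓝 0, U y = S y (U (r • y)))
    (hconj : ∀ V : (Fin n → ℂ) → (Fin n → ℂ), AnalyticOnNhd ℂ V Set.univ → V =ᶠ[𝓝 0] U →
      (∀ y, V y = S y (V (r • y))) → ∀ y, lam • f (V y) = V (lam • y)) :
    ∃ k, IsGlobalPreconjugation lam f k := by
  obtain ⟨V, hV, hVU, hVS⟩ := exists_analytic_extension hr hS hU heq
  exact ⟨V, hV, by rw [hVU.self_of_nhds, hU0], hUd.congr_of_eventuallyEq hVU,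
    hconj V hV hVU hVS⟩

theorem IsCubicHomogeneous.exists_globalPreconjugation (hf : IsCubicHomogeneous f)
    (hfp : IsPolynomialMap f) {lam : ℂ} (h0 : lam ≠ 0) (h1 : ‖lam‖ ≠ 1)
    (h : 1 < ‖lam‖ ∨ Function.Bijective f) : ∃ k, IsGlobalPreconjugation lam f k := by
  obtain ⟨U, hU, hU0, hUd, hUc⟩ := hf.exists_local_conj h0 h1
  by_cases hlt : 1 < ‖lam‖
  · have ht : Tendsto (fun y : Fin n → ℂ => lam⁻¹ • y) (𝓝 0) (𝓝 0) := by
      have hc : Continuous fun y : Fin n → ℂ => lam⁻¹ • y := by fun_prop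
      simpa using hc.tendsto 0
    refine exists_globalPreconjugation_of_extension (r := lam⁻¹) (S := fun _ u => lam • f u)
      (by rw [norm_inv]; exact inv_lt_one_of_one_lt₀ hlt) (fun p => ?_) hU hU0 hUd ?_ ?_
    · exact AnalyticAt.fun_const_smul ((hf.analyticAt p.2).comp (f := Prod.snd) analyticAt_snd)
    · filter_upwards [ht.eventually hUc] with y hy
      rw [hy, smul_inv_smul₀ h0]
    · intro V _ _ hV y
      rw [hV (lam • y), inv_smul_smul₀ h0]
  · have hlt' : ‖lam‖ < 1 := lt_of_le_of_ne (not_lt.1 hlt) h1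
    obtain ⟨e, he⟩ := Function.bijective_iff_has_inverse.1 (h.resolve_left hlt)
    have hep : AnalyticOnNhd ℂ e Set.univ := (hfp.of_isInverse he).analyticOnNhd
    refine exists_globalPreconjugation_of_extension (r := lam) (S := fun _ u => e (lam⁻¹ • u))
      hlt' (fun p => ?_) hU hU0 hUd ?_ ?_
    · exact (hep _ trivial).comp (f := fun p : (Fin n → ℂ) × (Fin n → ℂ) => lam⁻¹ • p.2)
        (AnalyticAt.fun_const_smul analyticAt_snd)
    · filter_upwards [hUc] with y hy
      rw [← hy, inv_smul_smul₀ h0, he.1]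
    · intro V _ _ hV y
      rw [hV y, he.2, smul_inv_smul₀ h0]

end CubicHomogeneous

/-! ### Transfer of pre-conjugations -/

section Transfer

open Filter Topology

variable {n N : ℕ} {f : (Fin n → ℂ) → (Fin n → ℂ)} {A : Matrix (Fin N) (Fin N) ℂ}
  {B : Matrix (Fin n) (Fin N) ℂ} {C : Matrix (Fin N) (Fin n) ℂ} {lam : ℂ}

/-- Multiplication by a matrix as a continuous linear map. -/
noncomputable def mulVecCLM {m l : ℕ} (M : Matrix (Fin l) (Fin m) ℂ) :
    (Fin m → ℂ) →L[ℂ] (Fin l → ℂ) :=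
  LinearMap.toContinuousLinearMap M.mulVecLin

@[simp]
theorem mulVecCLM_apply {m l : ℕ} (M : Matrix (Fin l) (Fin m) ℂ) (x : Fin m → ℂ) :
    mulVecCLM M x = M *ᵥ x := rfl

theorem tendsto_mulVec_zero {m l : ℕ} (M : Matrix (Fin l) (Fin m) ℂ) :
    Tendsto (fun x => M *ᵥ x) (𝓝 0) (𝓝 0) := by
  have h := (mulVecCLM M).continuous.tendsto 0
  rwa [map_zero] at h

theorem AnalyticAt.mulVec_comp_mulVec {K : (Fin N → ℂ) → (Fin N → ℂ)} {x : Fin n → ℂ}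
    (hK : AnalyticAt ℂ K (C *ᵥ x)) : AnalyticAt ℂ (fun x => B *ᵥ K (C *ᵥ x)) x :=
  ((mulVecCLM B).analyticAt _).comp
    (AnalyticAt.comp (f := mulVecCLM C) hK ((mulVecCLM C).analyticAt x))

theorem hasFDerivAt_mulVec_comp_mulVec (hBC : B * C = 1) {K : (Fin N → ℂ) → (Fin N → ℂ)}
    (hK : HasFDerivAt K (ContinuousLinearMap.id ℂ (Fin N → ℂ)) 0) :
    HasFDerivAt (fun x => B *ᵥ K (C *ᵥ x)) (ContinuousLinearMap.id ℂ (Fin n → ℂ)) 0 := by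
  have h0 : mulVecCLM C 0 = 0 := map_zero _
  rw [← h0] at hK
  refine ((mulVecCLM B).hasFDerivAt.comp 0
    (hK.comp (0 : Fin n → ℂ) (mulVecCLM C).hasFDerivAt)).congr_fderiv ?_
  refine ContinuousLinearMap.ext fun x => ?_
  exact IsLift.mulVec_mulVec hBC x

theorem Paired.conj_of_conj (h : Paired f A B C) {K : (Fin N → ℂ) → (Fin N → ℂ)} {x : Fin n → ℂ}
    (hK : lam • cubicLinear A (K (C *ᵥ x)) = K (lam • C *ᵥ x)) :
    lam • f (B *ᵥ K (C *ᵥ x)) = B *ᵥ K (C *ᵥ (lam • x)) := by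
  rw [h.isLift.map_mulVec, ← mulVec_smul, hK, mulVec_smul]

theorem Paired.globalPreconjugation_induced (h : Paired f A B C) {K : (Fin N → ℂ) → (Fin N → ℂ)}
    (hK : IsGlobalPreconjugation lam (cubicLinear A) K) :
    IsGlobalPreconjugation lam f fun x => B *ᵥ K (C *ᵥ x) where
  analytic _ _ := (hK.analytic _ trivial).mulVec_comp_mulVec
  map_zero := by rw [mulVec_zero, hK.map_zero, mulVec_zero]
  deriv_zero := hasFDerivAt_mulVec_comp_mulVec h.mul_eq_one hK.deriv_zero
  conj _ := h.conj_of_conj (hK.conj _)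

/-- The modification of `K` which commutes with translations along `ker B`. -/
def translationInvariant (B : Matrix (Fin n) (Fin N) ℂ) (C : Matrix (Fin N) (Fin n) ℂ)
    (K : (Fin N → ℂ) → (Fin N → ℂ)) (X : Fin N → ℂ) : Fin N → ℂ :=
  K (C *ᵥ (B *ᵥ X)) + (X - C *ᵥ (B *ᵥ X))

theorem mulVec_translationInvariant (hBC : B * C = 1) (K : (Fin N → ℂ) → (Fin N → ℂ))
    (X : Fin N → ℂ) : B *ᵥ translationInvariant B C K X = B *ᵥ K (C *ᵥ (B *ᵥ X)) := by
  rw [translationInvariant, mulVec_add, IsLift.mulVec_sub_section hBC, add_zero]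

theorem AnalyticAt.translationInvariant {K : (Fin N → ℂ) → (Fin N → ℂ)} {X : Fin N → ℂ}
    (hK : AnalyticAt ℂ K (C *ᵥ (B *ᵥ X))) : AnalyticAt ℂ (translationInvariant B C K) X := by
  have hCB := ((mulVecCLM C).comp (mulVecCLM B)).analyticAt X
  exact (AnalyticAt.comp (f := (mulVecCLM C).comp (mulVecCLM B)) hK hCB).add
    (analyticAt_id.sub hCB)

theorem hasFDerivAt_translationInvariant {K : (Fin N → ℂ) → (Fin N → ℂ)}
    (hK : HasFDerivAt K (ContinuousLinearMap.id ℂ (Fin N → ℂ)) 0) :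
    HasFDerivAt (translationInvariant B C K) (ContinuousLinearMap.id ℂ (Fin N → ℂ)) 0 := by
  let P := (mulVecCLM C).comp (mulVecCLM B)
  have h0 : P 0 = 0 := map_zero _
  rw [← h0] at hK
  refine ((hK.comp (0 : Fin N → ℂ) P.hasFDerivAt).add
    ((hasFDerivAt_id (0 : Fin N → ℂ)).sub P.hasFDerivAt)).congr_fderiv ?_
  refine ContinuousLinearMap.ext fun x => ?_
  simp

theorem translationInvariant_zero {K : (Fin N → ℂ) → (Fin N → ℂ)} (hK : K 0 = 0) :
    translationInvariant B C K 0 = 0 := by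
  simp [translationInvariant, hK]

theorem Paired.conj_translationInvariant (h : Paired f A B C) {K : (Fin N → ℂ) → (Fin N → ℂ)}
    {X : Fin N → ℂ}
    (hK : lam • cubicLinear A (K (C *ᵥ (B *ᵥ X))) = K (lam • C *ᵥ (B *ᵥ X))) :
    lam • cubicLinear A (translationInvariant B C K X) =
      translationInvariant B C K (lam • X) := by
  rw [translationInvariant, h.isLift.apply_add _ _ (IsLift.mulVec_sub_section h.mul_eq_one X),
    smul_add, hK, translationInvariant, mulVec_smul, mulVec_smul, smul_sub]

/-- Averaging is unnecessary: `translationInvariant B C K` is again a global pre-conjugation, so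
uniqueness identifies it with `K`. Likewise `k` is the map induced by `K`. -/
theorem Paired.isLift_preconjugation (h : Paired f A B C) (hf : IsCubicHomogeneous f)
    (h0 : lam ≠ 0) (h1 : ‖lam‖ ≠ 1) {k : (Fin n → ℂ) → (Fin n → ℂ)}
    {K : (Fin N → ℂ) → (Fin N → ℂ)} (hk : IsGlobalPreconjugation lam f k)
    (hK : IsGlobalPreconjugation lam (cubicLinear A) K) : IsLift B C k K where
  mul_eq_one := h.mul_eq_one
  apply_eq := congrFun ((h.globalPreconjugation_induced hK).eq hf h0 h1 hk)
  apply_add X v hv := by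
    have hK' : IsGlobalPreconjugation lam (cubicLinear A) (translationInvariant B C K) :=
      ⟨fun _ _ => (hK.analytic _ trivial).translationInvariant,
        translationInvariant_zero hK.map_zero, hasFDerivAt_translationInvariant hK.deriv_zero,
        fun _ => h.conj_translationInvariant (hK.conj _)⟩
    have e := congrFun (hK'.eq (isCubicHomogeneous_cubicLinear A) h0 h1 hK)
    rw [e, e, translationInvariant, translationInvariant, mulVec_add, hv, add_zero]
    abel

/-- A solution of `K (lam X) = lam (K X - (A K X) ^ 3)`, rewritten with the induced map. -/
theorem Paired.mulVec_cube_eq (h : Paired f A B C) {X Y : Fin N → ℂ} {y : Fin n → ℂ}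
    (hy : B *ᵥ Y = y) (hX : lam • cubicLinear A Y = X) :
    X = lam • Y - lam • (A *ᵥ (C *ᵥ y)) ^ 3 := by
  rw [← hX, ← hy, h.mulVec_section, cubicLinear, smul_sub]

theorem Paired.exists_globalPreconjugation_lift (h : Paired f A B C) (hf : IsCubicHomogeneous f)
    (h0 : lam ≠ 0) (hlt : ‖lam‖ < 1) {k : (Fin n → ℂ) → (Fin n → ℂ)}
    (hk : IsGlobalPreconjugation lam f k) :
    ∃ K, IsGlobalPreconjugation lam (cubicLinear A) K := by
  obtain ⟨U, hU, hU0, hUd, hUc⟩ :=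
    (isCubicHomogeneous_cubicLinear A).exists_local_conj h0 hlt.ne
  let W := translationInvariant B C U
  have hlW : (fun x => B *ᵥ U (C *ᵥ x)) =ᶠ[𝓝 0] k := by
    refine hk.eq_of_eventually_conj hf h0 hlt.ne
      (AnalyticAt.mulVec_comp_mulVec (by rwa [mulVec_zero])) (by simp [hU0])
      (hasFDerivAt_mulVec_comp_mulVec h.mul_eq_one hUd) ?_
    filter_upwards [(tendsto_mulVec_zero C).eventually hUc] with x hx
    exact h.conj_of_conj hx
  have hBW : ∀ᶠ Y in 𝓝 0, B *ᵥ W Y = k (B *ᵥ Y) := by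
    filter_upwards [(tendsto_mulVec_zero B).eventually hlW] with Y hY
    rw [← hY, mulVec_translationInvariant h.mul_eq_one]
  have hWc : ∀ᶠ Y in 𝓝 0, lam • cubicLinear A (W Y) = W (lam • Y) := by
    filter_upwards [((tendsto_mulVec_zero C).comp (tendsto_mulVec_zero B)).eventually hUc]
      with Y hY
    exact h.conj_translationInvariant hY
  -- The cubic term, now a known entire function of `Y`; the equation becomes `V Y = V (lam Y) / lam
  -- + Q Y`, which needs no inverse of `F`.
  let Q : (Fin N → ℂ) → (Fin N → ℂ) := fun Y => (A *ᵥ (C *ᵥ k (B *ᵥ Y))) ^ 3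
  have hkB : AnalyticOnNhd ℂ (fun Y => k (B *ᵥ Y)) Set.univ := fun Y _ =>
    AnalyticAt.comp (f := mulVecCLM B) (hk.analytic _ trivial) ((mulVecCLM B).analyticAt Y)
  have hQ : ∀ Y, AnalyticAt ℂ Q Y := fun Y =>
    AnalyticAt.pow ((((mulVecCLM A).comp (mulVecCLM C)).analyticAt _).comp (hkB Y trivial)) 3
  refine exists_globalPreconjugation_of_extension (r := lam) (U := W)
    (S := fun Y u => lam⁻¹ • u + Q Y) hlt (fun p => ?_)
    (AnalyticAt.translationInvariant (by simpa using hU)) (translationInvariant_zero hU0)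
    (hasFDerivAt_translationInvariant hUd) ?_ ?_
  · exact (AnalyticAt.fun_const_smul analyticAt_snd).add
      ((hQ p.1).comp (f := Prod.fst) analyticAt_fst)
  · filter_upwards [hBW, hWc] with Y h2 h3
    rw [h.mulVec_cube_eq h2 h3, ← smul_sub, inv_smul_smul₀ h0, sub_add_cancel]
  · intro V hV hVW hVS Y
    -- Analytic continuation of the local identity; it turns `Q` back into the cube of `A V`.
    have hBV : (fun Y => B *ᵥ V Y) = fun Y => k (B *ᵥ Y) := by
      refine AnalyticOnNhd.eq_of_eventuallyEq (𝕜 := ℂ) (z₀ := 0)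
        (fun Y _ => ((mulVecCLM B).analyticAt _).comp (hV Y trivial)) hkB ?_
      filter_upwards [hVW, hBW] with Y h2 h3
      rw [h2, h3]
    have h4 := hVS Y
    have h5 : V (lam • Y) = lam • V Y - lam • Q Y := by
      rw [h4, smul_add, smul_inv_smul₀ h0, add_sub_cancel_right]
    rw [h5]
    exact h.mulVec_cube_eq (congrFun hBV Y) rfl

end Transfer

/-! ### Transfer of polynomiality -/

section PolynomialTransfer

open Filter Topology

/-- Monomials of degree at least two have zero derivative at the origin. -/
theorem MvPolynomial.hasFDerivAt_eval_zero {n : ℕ} (p : MvPolynomial (Fin n) ℂ)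
    (hp : ∀ s ∈ p.support, 2 ≤ Finsupp.degree s) :
    HasFDerivAt (fun y : Fin n → ℂ => MvPolynomial.eval y p) (0 : (Fin n → ℂ) →L[ℂ] ℂ) 0 := by
  have hd := ((AnalyticOnNhd.eval_mvPolynomial (𝕜 := ℂ) p) 0 trivial).differentiableAt.hasFDerivAt
  have hsum : ∀ (t : ℂ) (y : Fin n → ℂ), MvPolynomial.eval (t • y) p =
      ∑ s ∈ p.support, t ^ (Finsupp.degree s) * (p.coeff s * ∏ i, y i ^ s i) := by
    intro t y
    rw [MvPolynomial.eval_eq']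
    refine Finset.sum_congr rfl fun s _ => ?_
    simp only [Pi.smul_apply, smul_eq_mul, mul_pow, Finset.prod_mul_distrib,
      Finset.prod_pow_eq_pow_sum, Finsupp.degree_eq_sum]
    ring
  refine hd.congr_fderiv (ContinuousLinearMap.ext fun y => ?_)
  let ℓ : ℂ →L[ℂ] (Fin n → ℂ) := (ContinuousLinearMap.id ℂ ℂ).smulRight y
  have h1 : HasDerivAt (fun t : ℂ => MvPolynomial.eval (t • y) p)
      (fderiv ℂ (fun y : Fin n → ℂ => MvPolynomial.eval y p) 0 y) 0 := by
    have h0 : ℓ 0 = 0 := map_zero _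
    rw [← h0] at hd
    have h3 := (hd.comp (0 : ℂ) ℓ.hasFDerivAt).hasDerivAt
    simp only [ContinuousLinearMap.comp_apply, h0] at h3
    simpa [ℓ] using! h3
  have h2 : HasDerivAt (fun t : ℂ => MvPolynomial.eval (t • y) p)
      (∑ s ∈ p.support, (0 : ℂ) * (p.coeff s * ∏ i, y i ^ s i)) 0 := by
    simp only [hsum]
    refine HasDerivAt.fun_sum fun s hs => HasDerivAt.mul_const ?_ _
    have h3 := hasDerivAt_pow (Finsupp.degree s) (0 : ℂ)
    rwa [zero_pow (by have := hp s hs; omega), mul_zero] at h3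
  rw [h1.unique h2]
  simp

/-- Polynomial solutions of the linear homological equation. -/
theorem MvPolynomial.exists_homological_solution {n : ℕ} {lam : ℂ} (h0 : lam ≠ 0)
    (h1 : ‖lam‖ ≠ 1) (p : MvPolynomial (Fin n) ℂ)
    (hp : ∀ s ∈ p.support, 2 ≤ Finsupp.degree s) :
    ∃ m : MvPolynomial (Fin n) ℂ, (∀ s ∈ m.support, 2 ≤ Finsupp.degree s) ∧
      ∀ y : Fin n → ℂ, MvPolynomial.eval (lam • y) m =
        lam * MvPolynomial.eval y m - lam * MvPolynomial.eval y p := by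
  -- In degree `d` the equation is `lam ^ d c = lam c - lam p`, which determines the coefficient
  -- `c`.
  let m : MvPolynomial (Fin n) ℂ := ∑ s ∈ p.support,
    MvPolynomial.monomial s (lam / (lam - lam ^ Finsupp.degree s) * p.coeff s)
  refine ⟨m, fun s hs => ?_, fun y => ?_⟩
  · obtain ⟨t, ht, hst⟩ := Finset.mem_biUnion.1 (MvPolynomial.support_sum hs)
    rw [Finset.mem_singleton.1 (MvPolynomial.support_monomial_subset hst)]
    exact hp t ht
  · have hne : ∀ s ∈ p.support, lam - lam ^ Finsupp.degree s ≠ 0 := by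
      intro s hs hz
      obtain ⟨e, he⟩ : ∃ e, Finsupp.degree s = e + 2 := ⟨_, (Nat.sub_add_cancel (hp s hs)).symm⟩
      rw [he, sub_eq_zero] at hz
      have h2 : lam ^ (e + 1) = 1 :=
        mul_right_cancel₀ h0 (by rw [← pow_succ, one_mul]; exact hz.symm)
      have h3 : ‖lam‖ ^ (e + 1) = 1 := by rw [← norm_pow, h2, norm_one]
      exact h1 ((pow_eq_one_iff_of_nonneg (norm_nonneg _) (by omega)).1 h3)
    rw [MvPolynomial.eval_eq' y p]
    simp only [m, map_sum, MvPolynomial.eval_monomial, Finsupp.prod_fintype _ _ fun _ => pow_zero _]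
    rw [Finset.mul_sum, Finset.mul_sum, ← Finset.sum_sub_distrib]
    refine Finset.sum_congr rfl fun s hs => ?_
    simp only [Pi.smul_apply, smul_eq_mul, mul_pow, Finset.prod_mul_distrib,
      Finset.prod_pow_eq_pow_sum, ← Finsupp.degree_eq_sum]
    have := hne s hs
    field_simp
    ring

variable {n N : ℕ} {f : (Fin n → ℂ) → (Fin n → ℂ)} {A : Matrix (Fin N) (Fin N) ℂ}
  {B : Matrix (Fin n) (Fin N) ℂ} {C : Matrix (Fin N) (Fin n) ℂ} {lam : ℂ}

/-- The linear equation for `K` has polynomial right-hand side, and the homological equation gives a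
polynomial correction `M` without terms of degree below two. Then `K - M ∘ B` conjugates the
identity map to itself, so uniqueness makes it the identity. -/
theorem IsLift.isPolynomialMap_of_preconjugation {k : (Fin n → ℂ) → (Fin n → ℂ)}
    {K : (Fin N → ℂ) → (Fin N → ℂ)} (hkK : IsLift B C k K) (h : Paired f A B C) (h0 : lam ≠ 0)
    (h1 : ‖lam‖ ≠ 1) (hk0 : k 0 = 0) (hK : IsGlobalPreconjugation lam (cubicLinear A) K)
    (hkp : IsPolynomialMap k) : IsPolynomialMap K := by
  obtain ⟨q, hq⟩ := hkp
  let l : Fin N → MvPolynomial (Fin n) ℂ := fun i => ∑ j, MvPolynomial.C ((A * C) i j) * q j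
  have hl : ∀ y i, MvPolynomial.eval y (l i) = (A *ᵥ (C *ᵥ k y)) i := by
    intro y i
    rw [Matrix.mulVec_mulVec]
    simp [l, mulVec, dotProduct, hq]
  have hsupp : ∀ i, ∀ s ∈ (l i ^ 3).support, 2 ≤ Finsupp.degree s := by
    intro i s hs
    have h2 : l i ∈ MvPolynomial.idealOfVars (Fin n) ℂ ^ 1 := by
      rw [MvPolynomial.mem_pow_idealOfVars_iff']
      intro x hx
      have hx0 : x = 0 := by rwa [Nat.lt_one_iff, Finsupp.degree_eq_zero_iff] at hx
      have h3 := hl 0 i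
      rw [hk0, mulVec_zero, mulVec_zero] at h3
      rw [hx0]
      simpa [MvPolynomial.eval_zero', MvPolynomial.constantCoeff_eq] using h3
    -- `l i` has no constant term because `k 0 = 0`, so its cube starts in degree three.
    rw [pow_one] at h2
    have h4 := (MvPolynomial.mem_pow_idealOfVars_iff 3 (l i ^ 3)).1 (Ideal.pow_mem_pow h2 3) s hs
    omega
  choose m hms hm using fun i => MvPolynomial.exists_homological_solution h0 h1 (l i ^ 3) (hsupp i)
  let M : (Fin n → ℂ) → (Fin N → ℂ) := fun y i => MvPolynomial.eval y (m i)
  have hMp : IsPolynomialMap M := ⟨m, fun _ _ => rfl⟩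
  have hMd : HasFDerivAt M (0 : (Fin n → ℂ) →L[ℂ] (Fin N → ℂ)) 0 :=
    hasFDerivAt_pi.2 fun i => (m i).hasFDerivAt_eval_zero (hms i)
  have hM0 : M 0 = 0 := by
    funext i
    have h3 : (m i).coeff 0 = 0 := MvPolynomial.notMem_support_iff.1 fun hs => by
      simpa using hms i 0 hs
    simpa [M, MvPolynomial.eval_zero', MvPolynomial.constantCoeff_eq] using h3
  have hMB : AnalyticOnNhd ℂ (fun X => M (B *ᵥ X)) Set.univ :=
    (hMp.comp (.mulVec B)).analyticOnNhd
  have hMlam : ∀ y, M (lam • y) = lam • M y - lam • (A *ᵥ (C *ᵥ k y)) ^ 3 := by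
    intro y
    funext i
    simp only [M, hm, Pi.sub_apply, Pi.smul_apply, smul_eq_mul, Pi.pow_apply, map_pow, hl]
  have hKlam : ∀ X, K (lam • X) = lam • K X - lam • (A *ᵥ (C *ᵥ k (B *ᵥ X))) ^ 3 := fun X =>
    h.mulVec_cube_eq (hkK.map_mulVec X).symm (hK.conj X)
  have hMBd : HasFDerivAt (fun X => M (B *ᵥ X)) (0 : (Fin N → ℂ) →L[ℂ] (Fin N → ℂ)) 0 := by
    have hB0 : mulVecCLM B 0 = 0 := map_zero _
    rw [← hB0] at hMd
    exact (hMd.comp (0 : Fin N → ℂ) (mulVecCLM B).hasFDerivAt).congr_fderiv (by simp)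
  have hKM : ∀ X, K X = X + M (B *ᵥ X) := by
    intro X
    have h5 := eqOn_ball_of_local_conj h0 h1 (f := id) (ρ := ‖X‖ + 1)
      (k := fun X => K X - M (B *ᵥ X)) (l := id) (hasStrictFDerivAt_id 0)
      (fun Y _ => (hK.analytic Y trivial).sub (hMB Y trivial)) (fun Y _ => analyticAt_id)
      (by simp [hK.map_zero, hM0]) rfl ((hK.deriv_zero.sub hMBd).congr_fderiv (sub_zero _))
      (hasFDerivAt_id 0)
      (Eventually.of_forall fun Y => by
        simp only [id, hKlam, mulVec_smul, hMlam, smul_sub]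
        abel)
      (Eventually.of_forall fun Y => rfl)
    have h6 := h5 (x := X) (by simp)
    exact sub_eq_iff_eq_add.1 h6
  rw [funext hKM]
  refine IsPolynomialMap.add ?_ (hMp.comp (.mulVec B))
  exact ⟨fun i => MvPolynomial.X i, fun _ _ => by simp⟩

end PolynomialTransfer

/-! ### Assembly -/

theorem theorem1p3 :
    -- every cubic-homogeneous map is paired with a cubic-linear map in a higher dimension
    (∀ (n : ℕ) (f : (Fin n → ℂ) → (Fin n → ℂ)), IsCubicHomogeneous f →
      ∃ N : ℕ, n < N ∧ ∃ (A : Matrix (Fin N) (Fin N) ℂ) (B : Matrix (Fin n) (Fin N) ℂ)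
        (C : Matrix (Fin N) (Fin n) ℂ), Paired f A B C) ∧
    -- every cubic-linear map is paired with a cubic-homogeneous map
    (∀ (N : ℕ) (A : Matrix (Fin N) (Fin N) ℂ),
      ∃ n : ℕ, n ≤ N ∧ (A.det = 0 → n < N) ∧
        ∃ (f : (Fin n → ℂ) → (Fin n → ℂ)) (B : Matrix (Fin n) (Fin N) ℂ)
          (C : Matrix (Fin N) (Fin n) ℂ), IsCubicHomogeneous f ∧ Paired f A B C) ∧
    -- transfer of properties and formulas for paired maps
    (∀ (n N : ℕ) (f : (Fin n → ℂ) → (Fin n → ℂ)) (A : Matrix (Fin N) (Fin N) ℂ)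
      (B : Matrix (Fin n) (Fin N) ℂ) (C : Matrix (Fin N) (Fin n) ℂ),
      IsCubicHomogeneous f → Paired f A B C →
      (Function.Injective f ↔ Function.Injective (cubicLinear A)) ∧
      (Function.Surjective f ↔ Function.Surjective (cubicLinear A)) ∧
      (HasPolynomialInverse f ↔ HasPolynomialInverse (cubicLinear A)) ∧
      ((∃ c : ℂ, ∀ x, jacobianDet f x = c) ↔ (∃ c : ℂ, ∀ X, jacobianDet (cubicLinear A) X = c)) ∧
      (∀ X, f (B *ᵥ X) = B *ᵥ cubicLinear A X) ∧
      (∀ x, jacobianDet f x = jacobianDet (cubicLinear A) (C *ᵥ x)) ∧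
      (∀ X, jacobianDet (cubicLinear A) X = jacobianDet f (B *ᵥ X)) ∧
      (∀ (finv : (Fin n → ℂ) → (Fin n → ℂ)) (Finv : (Fin N → ℂ) → (Fin N → ℂ)),
        IsInverse finv f → IsInverse Finv (cubicLinear A) →
        (∀ y, finv y = B *ᵥ Finv (C *ᵥ y)) ∧
        (∀ Y, Finv Y = Y - cubicLinear A (C *ᵥ finv (B *ᵥ Y)) + C *ᵥ finv (B *ᵥ Y))) ∧
      (∀ lam : ℂ, lam ≠ 0 → ‖lam‖ ≠ 1 →
        -- there is at most one global pre-conjugation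
        {k | IsGlobalPreconjugation lam f k}.Subsingleton ∧
        {K | IsGlobalPreconjugation lam (cubicLinear A) K}.Subsingleton ∧
        -- its existence transfers, and is guaranteed in two cases
        ((∃ k, IsGlobalPreconjugation lam f k) ↔
          (∃ K, IsGlobalPreconjugation lam (cubicLinear A) K)) ∧
        (1 < ‖lam‖ ∨ Function.Bijective f → ∃ k, IsGlobalPreconjugation lam f k) ∧
        (1 < ‖lam‖ ∨ Function.Bijective (cubicLinear A) →
          ∃ K, IsGlobalPreconjugation lam (cubicLinear A) K) ∧
        -- its properties transfer, with the formulas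
        (∀ (k : (Fin n → ℂ) → (Fin n → ℂ)) (K : (Fin N → ℂ) → (Fin N → ℂ)),
          IsGlobalPreconjugation lam f k → IsGlobalPreconjugation lam (cubicLinear A) K →
          (Function.Surjective k ↔ Function.Surjective K) ∧
          (Function.Injective k ↔ Function.Injective K) ∧
          (IsPolynomialMap k ↔ IsPolynomialMap K) ∧
          (HasPolynomialInverse k ↔ HasPolynomialInverse K) ∧
          (∀ x, k x = B *ᵥ K (C *ᵥ x)) ∧
          (∀ X, k (B *ᵥ X) = B *ᵥ K X) ∧
          (∀ (kinv : (Fin n → ℂ) → (Fin n → ℂ)) (Kinv : (Fin N → ℂ) → (Fin N → ℂ)),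
            IsInverse kinv k → IsInverse Kinv K →
            (∀ y, kinv y = B *ᵥ Kinv (C *ᵥ y)) ∧
            (∀ Y, Kinv Y = Y - K (C *ᵥ kinv (B *ᵥ Y)) + C *ᵥ kinv (B *ᵥ Y)))))) := by
  refine ⟨exists_paired_cubicLinear, exists_paired_cubicHomogeneous, ?_⟩
  intro n N f A B C hf h
  have hF := isCubicHomogeneous_cubicLinear A
  have hFp := isPolynomialMap_cubicLinear A
  refine ⟨h.isLift.injective_iff, h.isLift.surjective_iff, ?_, h.jacobianDet_const_iff,
    h.isLift.map_mulVec, h.jacobianDet_eq, h.jacobianDet_cubicLinear_eq,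
    fun finv Finv hfi hFi => h.isLift.inverse_eq hfi hFi, ?_⟩
  · rw [h.isPolynomialMap.hasPolynomialInverse_iff, hFp.hasPolynomialInverse_iff,
      h.isLift.bijective_iff]
  intro lam h0 h1
  have hex : 1 < ‖lam‖ ∨ Function.Bijective f → ∃ k, IsGlobalPreconjugation lam f k :=
    hf.exists_globalPreconjugation h.isPolynomialMap h0 h1
  have hEx : 1 < ‖lam‖ ∨ Function.Bijective (cubicLinear A) →
      ∃ K, IsGlobalPreconjugation lam (cubicLinear A) K :=
    hF.exists_globalPreconjugation hFp h0 h1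
  refine ⟨fun k hk l hl => hl.eq hf h0 h1 hk, fun K hK L hL => hL.eq hF h0 h1 hK,
    ⟨fun ⟨k, hk⟩ => ?_, fun ⟨K, hK⟩ => ⟨_, h.globalPreconjugation_induced hK⟩⟩, hex, hEx, ?_⟩
  -- Only `‖lam‖ < 1` needs the given `k`; for `‖lam‖ > 1` existence is unconditional.
  · rcases h1.lt_or_gt with hlt | hgt
    · exact h.exists_globalPreconjugation_lift hf h0 hlt hk
    · exact hEx (.inl hgt)
  intro k K hk hK
  have hkK := h.isLift_preconjugation hf h0 h1 hk hK
  have hpoly : IsPolynomialMap k → IsPolynomialMap K :=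
    hkK.isPolynomialMap_of_preconjugation h h0 h1 hk.map_zero hK
  have hpoly' : IsPolynomialMap K → IsPolynomialMap k := fun hp => by
    rw [funext hkK.apply_eq]
    exact (IsPolynomialMap.mulVec B).comp (hp.comp (.mulVec C))
  refine ⟨hkK.surjective_iff, hkK.injective_iff, ⟨hpoly, hpoly'⟩, ⟨fun hp => ?_, fun hp => ?_⟩,
    hkK.apply_eq, hkK.map_mulVec, fun kinv Kinv hki hKi => hkK.inverse_eq hki hKi⟩
  · have hk' := hp.isPolynomialMap
    exact (hpoly hk').hasPolynomialInverse_iff.2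
      (hkK.bijective_iff.1 (hk'.hasPolynomialInverse_iff.1 hp))
  · have hK' := hp.isPolynomialMap
    exact (hpoly' hK').hasPolynomialInverse_iff.2
      (hkK.bijective_iff.2 (hK'.hasPolynomialInverse_iff.1 hp))
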